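/- **Setting.** Let $m\ge 1$, $n,r\ge 0$ be integers and let $G(\lambda)\in\mathbb C(\lambda)^{n\times n}$ be given by a realization $$G(\lambda)=P(\lambda)+C(\lambda E-A)^{-1}B,\qquad P(\lambda)=\sum_{j=0}^m\lambda^jA_j,\quad A_m\ne 0,$$ with $A_j\in\mathbb C^{n\times n}$, $A,E\in\mathbb C^{r\times r}$, $E$ nonsingular, $C\in\mathbb C^{n\times r}$, $B\in\mathbb C^{r\times n}$, which is *minimal*: no realization $P'(\lambda)+C'(\lambda E'-A')^{-1}B'$ of $G(\lambda)$ ($P'(\lambda)$ a matrix polynomial, $E'$ nonsingular) has a pencil $\lambda E'-A'$ of size smaller than $r$. Let $\mathcal S(\lambda)=\begin{bmatrix}P(\lambda)&C\\B&A-\lambda E\end{bmatrix}$ be its system matrix; a system matrix is called *irreducible* if its realization is minimal. **Fiedler matrices.** For $X\in\mathbb C^{n\times n}$ define $mn\times mn$ matrices $M_0(X)=\operatorname{diag}(I_{(m-1)n},X)$, $M_{-m}(X)=\operatorname{diag}(X,I_{(m-1)n})$ and, for $1\le i\le m-1$, $$M_i(X)=\operatorname{diag}\Big(I_{(m-i-1)n},\begin{bmatrix}X&I_n\\I_n&0\end{bmatrix},I_{(i-1)n}\Big),\qquad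 M_{-i}(X)=\operatorname{diag}\Big(I_{(m-i-1)n},\begin{bmatrix}0&I_n\\I_n&X\end{bmatrix},I_{(i-1)n}\Big).$$ Put $\mathbb M_i(X)=\operatorname{diag}(M_i(X),I_r)$ for $-m\le i\le m-1$, $M_i^P=M_i(-A_i)$ for $i\ge 0$, $M_i^P=M_i(A_{-i})$ for $i<0$, and $$\mathbb M_0^{\mathcal S}=\begin{bmatrix}M_0^P&-e_m\otimes C\\-e_m^T\otimes B&-A\end{bmatrix},\quad \mathbb M_{-m}^{\mathcal S}=\begin{bmatrix}M_{-m}^P&0\\0&-E\end{bmatrix},\quad \mathbb M_i^{\mathcal S}=\begin{bmatrix}M_i^P&0\\0&I_r\end{bmatrix},\quad \mathbb M_{-i}^{\mathcal S}=(\mathbb M_i^{\mathcal S})^{-1}\quad(1\le i\le m-1),$$ where $e_m$ is the last column of $I_m$. For an index tuple $\mathbf t=(t_1,\dots,t_k)$ with entries in $\{-m,\dots,m-1\}$ put $\mathbb M_{\mathbf t}^{\mathcal S}=\mathbb M_{t_1}^{\mathcal S}\cdots\mathbb M_{t_k}^{\mathcal S}$, and for a tuple $X=(X_1,\dots,X_k)$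 of $n\times n$ matrices (a *matrix assignment* for $\mathbf t$) put $\mathbb M_{\mathbf t}(X)=\mathbb M_{t_1}(X_1)\cdots\mathbb M_{t_k}(X_k)$. The assignment is *nonsingular* if $X_j$ is nonsingular whenever $t_j\in\{0,-m\}$. A tuple satisfies the *successor infix property* (SIP) if between any two equal entries $i$ there is an entry $i+1$. **GFPRs.** Let $0\le h\le m-1$, let $\sigma$ and $\tau$ be permutations of $\{0,\dots,h\}$ and $\{-m,\dots,-h-1\}$, let $\sigma_1,\sigma_2$ be index tuples with entries in $\{0,\dots,h-1\}$ such that $(\sigma_1,\sigma,\sigma_2)$ satisfies the SIP, and let $\tau_1,\tau_2$ be index tuples with entries in $\{-m,\dots,-h-2\}$ such that $(\tau_1,\tau,\tau_2)$ satisfies the SIP. Let $X_1,X_2,Y_1,Y_2$ be matrix assignments for $\sigma_1,\sigma_2,\tau_1,\tau_2$. The pencil $$\mathbb L(\lambda)=\mathbb M_{\tau_1}(Y_1)\,\mathbb M_{\sigma_1}(X_1)\,(\lambda\mathbb M_\tau^{\mathcal S}-\mathbb M_\sigma^{\mathcal S})\,\mathbb M_{\sigma_2}(X_2)\,\mathbb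 M_{\tau_2}(Y_2)$$ is called a generalized Fiedler pencil with repetition (GFPR) of $G(\lambda)$. **Theorem.** If $X_1,X_2,Y_1,Y_2$ are all nonsingular matrix assignments, then the GFPR $\mathbb L(\lambda)$ is a *Rosenbrock strong linearization* of $G(\lambda)$. That is, $\mathbb L(\lambda)=\begin{bmatrix}\mathcal X-\lambda\mathcal Y&\mathcal C\\\mathcal B&H-\lambda K\end{bmatrix}$ with constant matrices $\mathcal X,\mathcal Y\in\mathbb C^{mn\times mn}$, $\mathcal C\in\mathbb C^{mn\times r}$, $\mathcal B\in\mathbb C^{r\times mn}$, $H,K\in\mathbb C^{r\times r}$, $K$ nonsingular; it is an irreducible system matrix of its transfer function $\mathbb G(\lambda)=\mathcal X-\lambda\mathcal Y+\mathcal C(\lambda K-H)^{-1}\mathcal B$; and (a) there are $mn\times mn$ unimodular matrix polynomials $U(\lambda),V(\lambda)$ (determinant a nonzero constant) and nonsingular $U_0,V_0\in\mathbb C^{r\times r}$ with $$\operatorname{diag}(U(\lambda),U_0)\;\mathbb L(\lambda)\;\operatorname{diag}(V(\lambda),V_0)=\operatorname{diag}(I_{(m-1)n},\mathcal S(\lambda));$$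 (b) there are $mn\times mn$ biproper rational matrices $\mathcal O_\ell(\lambda),\mathcal O_r(\lambda)$ (converging to a nonsingular matrix as $\lambda\to\infty$) with $$\mathcal O_\ell(\lambda)\,\lambda^{-1}\mathbb G(\lambda)\,\mathcal O_r(\lambda)=\operatorname{diag}(I_{(m-1)n},\lambda^{-m}G(\lambda)).$$ -/

import Mathlib

open Polynomial

/-- A realization `P(λ) + C (λ E - A)⁻¹ B` of an `ι × ι` rational matrix over `ℂ`, with matrix
polynomial `P(λ)` and an `r × r` pencil `λ E - A` whose leading coefficient `E` is nonsingular. -/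
structure Realization (ι : Type) (r : ℕ) where
  /-- the polynomial part `P(λ)` -/
  P : Matrix ι ι ℂ[X]
  A : Matrix (Fin r) (Fin r) ℂ
  E : Matrix (Fin r) (Fin r) ℂ
  B : Matrix (Fin r) ι ℂ
  C : Matrix ι (Fin r) ℂ
  det_E_ne_zero : E.det ≠ 0

namespace Realization

/-- The rational matrix `P(λ) + C (λ E - A)⁻¹ B` that is realized (the transfer function).
The matrix `λ E - A` is invertible over `ℂ(λ)`, because `E` is nonsingular. -/
noncomputable def transfer {ι : Type} {r : ℕ} (R : Realization ι r) :
    Matrix ι ι (RatFunc ℂ) :=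
  R.P.map (algebraMap ℂ[X] (RatFunc ℂ)) +
    R.C.map RatFunc.C *
      ((RatFunc.X : RatFunc ℂ) • R.E.map RatFunc.C - R.A.map RatFunc.C)⁻¹ *
      R.B.map RatFunc.C

/-- The Rosenbrock system matrix `[P(λ), C; B, A - λ E]`. -/
noncomputable def systemMatrix {ι : Type} {r : ℕ} (R : Realization ι r) :
    Matrix (ι ⊕ Fin r) (ι ⊕ Fin r) ℂ[X] :=
  Matrix.fromBlocks R.P (R.C.map Polynomial.C) (R.B.map Polynomial.C)
    (R.A.map Polynomial.C - (X : ℂ[X]) • R.E.map Polynomial.C)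

/-- A realization is minimal (its system matrix is irreducible) if the size of its pencil
`λ E - A` is the smallest among all realizations of the same rational matrix. -/
def IsMinimal {ι : Type} {r : ℕ} (R : Realization ι r) : Prop :=
  ∀ (r' : ℕ) (R' : Realization ι r'), R'.transfer = R.transfer → r ≤ r'

/-- The coefficient `A_j` of `λ ^ j` in the polynomial part `P(λ)`. -/
noncomputable def coeff {ι : Type} {r : ℕ} (R : Realization ι r) (j : ℕ) : Matrix ι ι ℂ :=
  R.P.map fun p => p.coeff j

end Realization

/-- A square matrix polynomial is unimodular if its determinant is a nonzero constant. -/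
def IsUnimodular {ι : Type} [Fintype ι] [DecidableEq ι] (U : Matrix ι ι ℂ[X]) : Prop :=
  ∃ c : ℂ, c ≠ 0 ∧ U.det = Polynomial.C c

/-- A square rational matrix `F(λ)` is biproper if `F(λ)` converges, as `λ → ∞` in `ℂ`, to a
nonsingular matrix. -/
def IsBiproper {ι : Type} [Fintype ι] [DecidableEq ι] (F : Matrix ι ι (RatFunc ℂ)) : Prop :=
  ∃ D : Matrix ι ι ℂ, D.det ≠ 0 ∧
    ∀ i j, Filter.Tendsto (fun z : ℂ => (F i j).eval (RingHom.id ℂ) z)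
      (Bornology.cobounded ℂ) (nhds (D i j))

/-- `diag(I_{(m-1)n}, W)`, as an `m × m` block matrix with `n × n` blocks. -/
def diagLast {K : Type} [Zero K] [One K] (m : ℕ) {n : ℕ} (W : Matrix (Fin n) (Fin n) K) :
    Matrix (Fin m × Fin n) (Fin m × Fin n) K :=
  Matrix.comp _ _ _ _ _
    (Matrix.diagonal fun p : Fin m => if (p : ℕ) + 1 = m then W else 1)

/-- `e_m ⊗ C`: the block column with `m` blocks, the last one `C` and the others zero. -/
def lastCol {K : Type} [Zero K] (m : ℕ) {n r : ℕ} (C : Matrix (Fin n) (Fin r) K) :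
    Matrix (Fin m × Fin n) (Fin r) K :=
  Matrix.of fun p k => if (p.1 : ℕ) + 1 = m then C p.2 k else 0

/-- `e_mᵀ ⊗ B`: the block row with `m` blocks, the last one `B` and the others zero. -/
def lastRow {K : Type} [Zero K] (m : ℕ) {n r : ℕ} (B : Matrix (Fin r) (Fin n) K) :
    Matrix (Fin r) (Fin m × Fin n) K :=
  Matrix.of fun k p => if (p.1 : ℕ) + 1 = m then B k p.2 else 0

/-- The matrix `diag(I_{(m-1)n}, 𝒮(λ))`, where `𝒮(λ)` is the system matrix of `R`. -/
noncomputable def Realization.extendedSystemMatrix {n r : ℕ} (R : Realization (Fin n) r) (m : ℕ) :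
    Matrix ((Fin m × Fin n) ⊕ Fin r) ((Fin m × Fin n) ⊕ Fin r) ℂ[X] :=
  Matrix.fromBlocks (diagLast m R.P) (lastCol m (R.C.map Polynomial.C))
    (lastRow m (R.B.map Polynomial.C))
    (R.A.map Polynomial.C - (X : ℂ[X]) • R.E.map Polynomial.C)

/-- `L(λ)` is a Rosenbrock strong linearization of `G(λ) = R.transfer` (with system matrix
`𝒮(λ) = R.systemMatrix` and polynomial part of degree `m`): it is the system matrix
`[𝒳 - λ 𝒴, 𝒞; ℬ, H - λ K]` of a minimal realization `T` whose polynomial part is a pencil, and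
* (a) `diag(U(λ), U₀) L(λ) diag(V(λ), V₀) = diag(I_{(m-1)n}, 𝒮(λ))` for some unimodular
  `U(λ)`, `V(λ)` and nonsingular `U₀`, `V₀`;
* (b) `O_ℓ(λ) λ⁻¹ 𝔾(λ) O_r(λ) = diag(I_{(m-1)n}, λ⁻ᵐ G(λ))` for some biproper `O_ℓ(λ)`, `O_r(λ)`,
  where `𝔾(λ)` is the transfer function of `L(λ)`. -/
def IsRosenbrockStrongLinearization {n r : ℕ} (m : ℕ) (R : Realization (Fin n) r)
    (L : Matrix ((Fin m × Fin n) ⊕ Fin r) ((Fin m × Fin n) ⊕ Fin r) ℂ[X]) : Prop :=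
  ∃ T : Realization (Fin m × Fin n) r,
    (∃ 𝒳 𝒴 : Matrix (Fin m × Fin n) (Fin m × Fin n) ℂ,
      T.P = 𝒳.map Polynomial.C - (X : ℂ[X]) • 𝒴.map Polynomial.C) ∧
    T.systemMatrix = L ∧
    T.IsMinimal ∧
    (∃ (U V : Matrix (Fin m × Fin n) (Fin m × Fin n) ℂ[X]) (U₀ V₀ : Matrix (Fin r) (Fin r) ℂ),
      IsUnimodular U ∧ IsUnimodular V ∧ U₀.det ≠ 0 ∧ V₀.det ≠ 0 ∧
      Matrix.fromBlocks U 0 0 (U₀.map Polynomial.C) * L *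
        Matrix.fromBlocks V 0 0 (V₀.map Polynomial.C) = R.extendedSystemMatrix m) ∧
    (∃ Ol Or : Matrix (Fin m × Fin n) (Fin m × Fin n) (RatFunc ℂ),
      IsBiproper Ol ∧ IsBiproper Or ∧
      Ol * ((RatFunc.X : RatFunc ℂ)⁻¹ • T.transfer) * Or =
        diagLast m (((RatFunc.X : RatFunc ℂ) ^ m)⁻¹ • R.transfer))

/-- The `n × n` blocks of the elementary matrix `M_i(W)`, `-m ≤ i ≤ m - 1`. The block rows and
columns are numbered `0, …, m - 1`, so that the `2 × 2` block pattern of `M_i(W)` and `M_{-i}(W)`,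
`1 ≤ i ≤ m - 1`, sits at the positions `m - i - 1` and `m - i`. -/
def elemBlocks (m : ℕ) {n : ℕ} (i : ℤ) (W : Matrix (Fin n) (Fin n) ℂ) :
    Matrix (Fin m) (Fin m) (Matrix (Fin n) (Fin n) ℂ) :=
  Matrix.of fun p q =>
    if i = 0 then
      if p = q then (if (p : ℤ) + 1 = m then W else 1) else 0
    else if i = -(m : ℤ) then
      if p = q then (if (p : ℤ) = 0 then W else 1) else 0
    else
      -- the upper left, upper right, lower left and lower right corners of the pattern
      if (p : ℤ) + |i| + 1 = m ∧ (q : ℤ) + |i| + 1 = m then (if 0 < i then W else 0)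
      else if (p : ℤ) + |i| + 1 = m ∧ (q : ℤ) + |i| = m then 1
      else if (p : ℤ) + |i| = m ∧ (q : ℤ) + |i| + 1 = m then 1
      else if (p : ℤ) + |i| = m ∧ (q : ℤ) + |i| = m then (if 0 < i then 0 else W)
      else if p = q then 1 else 0

/-- The elementary matrix `M_i(W)` of size `mn × mn`. -/
def elemM (m : ℕ) {n : ℕ} (i : ℤ) (W : Matrix (Fin n) (Fin n) ℂ) :
    Matrix (Fin m × Fin n) (Fin m × Fin n) ℂ :=
  Matrix.comp _ _ _ _ _ (elemBlocks m i W)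

/-- The elementary matrix `𝕄_i(W) = diag(M_i(W), I_r)` of size `(mn + r) × (mn + r)`. -/
def elemMM (m : ℕ) {n : ℕ} (r : ℕ) (i : ℤ) (W : Matrix (Fin n) (Fin n) ℂ) :
    Matrix ((Fin m × Fin n) ⊕ Fin r) ((Fin m × Fin n) ⊕ Fin r) ℂ :=
  Matrix.fromBlocks (elemM m i W) 0 0 1

/-- The product `𝕄_t(W) = 𝕄_{t₁}(W₁) ⋯ 𝕄_{t_k}(W_k)` for an index tuple `t` and a matrix
assignment `W` for `t`. -/
def elemMMTuple (m : ℕ) {n : ℕ} (r : ℕ) (t : List ℤ)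
    (W : Fin t.length → Matrix (Fin n) (Fin n) ℂ) :
    Matrix ((Fin m × Fin n) ⊕ Fin r) ((Fin m × Fin n) ⊕ Fin r) ℂ :=
  (List.ofFn fun j => elemMM m r (t.get j) (W j)).prod

/-- A matrix assignment for `t` is nonsingular if the matrices assigned to the positions occupied
by the indices `0` and `-m` are nonsingular. -/
def IsNonsingularAssignment (m : ℕ) {n : ℕ} (t : List ℤ)
    (W : Fin t.length → Matrix (Fin n) (Fin n) ℂ) : Prop :=
  ∀ j, t.get j = 0 ∨ t.get j = -(m : ℤ) → (W j).det ≠ 0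

namespace Realization

/-- The Fiedler matrix `M_i^P`: `M_i(-A_i)` for `i ≥ 0` and `M_i(A_{-i})` for `i < 0`. -/
noncomputable def fiedlerP {n r : ℕ} (R : Realization (Fin n) r) (m : ℕ) (i : ℤ) :
    Matrix (Fin m × Fin n) (Fin m × Fin n) ℂ :=
  if 0 ≤ i then elemM m i (-R.coeff i.natAbs) else elemM m i (R.coeff i.natAbs)

/-- The Fiedler matrix `𝕄_i^𝒮`, `-m ≤ i ≤ m - 1`, of the system matrix `𝒮(λ)` of `R`. -/
noncomputable def fiedlerS {n r : ℕ} (R : Realization (Fin n) r) (m : ℕ) (i : ℤ) :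
    Matrix ((Fin m × Fin n) ⊕ Fin r) ((Fin m × Fin n) ⊕ Fin r) ℂ :=
  if i = 0 then
    Matrix.fromBlocks (R.fiedlerP m 0) (-lastCol m R.C) (-lastRow m R.B) (-R.A)
  else if i = -(m : ℤ) then
    Matrix.fromBlocks (R.fiedlerP m (-(m : ℤ))) 0 0 (-R.E)
  else if 0 < i then
    Matrix.fromBlocks (R.fiedlerP m i) 0 0 1
  else
    (Matrix.fromBlocks (R.fiedlerP m (-i)) 0 0 1)⁻¹

/-- The product `𝕄_t^𝒮 = 𝕄_{t₁}^𝒮 ⋯ 𝕄_{t_k}^𝒮` for an index tuple `t`. -/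
noncomputable def fiedlerSTuple {n r : ℕ} (R : Realization (Fin n) r) (m : ℕ) (t : List ℤ) :
    Matrix ((Fin m × Fin n) ⊕ Fin r) ((Fin m × Fin n) ⊕ Fin r) ℂ :=
  (t.map (R.fiedlerS m)).prod

/-- The pencil
`𝕄_{τ₁}(Y₁) 𝕄_{σ₁}(X₁) (λ 𝕄_τ^𝒮 - 𝕄_σ^𝒮) 𝕄_{σ₂}(X₂) 𝕄_{τ₂}(Y₂)`. -/
noncomputable def gfprPencil {n r : ℕ} (R : Realization (Fin n) r) (m : ℕ)
    (σ τ σ₁ σ₂ τ₁ τ₂ : List ℤ)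
    (X₁ : Fin σ₁.length → Matrix (Fin n) (Fin n) ℂ)
    (X₂ : Fin σ₂.length → Matrix (Fin n) (Fin n) ℂ)
    (Y₁ : Fin τ₁.length → Matrix (Fin n) (Fin n) ℂ)
    (Y₂ : Fin τ₂.length → Matrix (Fin n) (Fin n) ℂ) :
    Matrix ((Fin m × Fin n) ⊕ Fin r) ((Fin m × Fin n) ⊕ Fin r) ℂ[X] :=
  (elemMMTuple m r τ₁ Y₁).map Polynomial.C * (elemMMTuple m r σ₁ X₁).map Polynomial.C *
    ((X : ℂ[X]) • (R.fiedlerSTuple m τ).map Polynomial.C -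
      (R.fiedlerSTuple m σ).map Polynomial.C) *
    (elemMMTuple m r σ₂ X₂).map Polynomial.C * (elemMMTuple m r τ₂ Y₂).map Polynomial.C

end Realization

/-- The index tuple `t` is a permutation of the set of integers `{a, a + 1, …, b}`. -/
def IsPermutationOf (t : List ℤ) (a b : ℤ) : Prop :=
  t.Nodup ∧ ∀ i : ℤ, i ∈ t ↔ a ≤ i ∧ i ≤ b

/-- The successor infix property: between any two equal entries `i` of the tuple there is an
entry `i + 1`. -/
def SatisfiesSIP (t : List ℤ) : Prop :=
  ∀ a b : Fin t.length, a < b → t.get a = t.get b →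
    ∃ c : Fin t.length, a < c ∧ c < b ∧ t.get c = t.get a + 1

/-
The constant factors attached to `σ₁`, `σ₂`, `τ₁`, `τ₂`, and the Fiedler matrices of the indices
`1, …, m - 1` occurring in `σ`, are nonsingular and of the form `diag(M, 1)`. Multiplying by such
factors preserves Rosenbrock strong linearizations, so only pencils `λ 𝕄_τ - 𝕄_0` with
`τ` a permutation of `{-m, …, -1}` remain.

The first diagonal block of such a pencil is `-1`, and its Schur complement is a pencil of the same
kind in which `A_{m-1} + λ A_m` takes the place of `A_m`. Iterating this (Horner's scheme) leaves
`diag(1, …, 1, P(λ))`, by transformations that fix the last block row and column, where the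
state-space part is attached; this is (a).

For (b), eliminate the state and divide by `λ`. Reversing the order of the blocks exchanges the
Fiedler matrices with their inverses, and turns the result into a pencil in `λ⁻¹` for the reversed
polynomial, with `A_0` replaced by `A_0 + C (λ E - A)⁻¹ B`. The same reduction then applies over
the ring of proper rational functions, in which an element is a unit if and only if its value at
infinity is nonzero.

Minimality passes from `G` to the transfer function `𝔾` because `G = M 𝔾 N` with polynomial
matrices `M`, `N`: dividing `M C'` and `B' N` by `λ E' - A'` turns every realization of `𝔾` into
one of `G` with a pencil of the same size.
-/

section Bordered

variable {S : Type*}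

/-- The block matrix `[a, y; x, D]` whose first row and first column have width one. -/
def bordered {m : ℕ} (a : S) (y x : Fin m → S) (D : Matrix (Fin m) (Fin m) S) :
    Matrix (Fin (m + 1)) (Fin (m + 1)) S :=
  Matrix.of (Fin.cons (Fin.cons a y) fun i => Fin.cons (x i) (D i))

theorem smul_bordered {K : Type*} [SMul K S] {m : ℕ} (c : K) (a : S) (y x : Fin m → S)
    (D : Matrix (Fin m) (Fin m) S) :
    c • bordered a y x D = bordered (c • a) (c • y) (c • x) (c • D) := by
  ext p q
  refine p.cases ?_ fun p => ?_ <;> refine q.cases ?_ fun q => ?_ <;> simp [bordered]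

theorem bordered_sub [Sub S] {m : ℕ} (a a' : S) (y x y' x' : Fin m → S)
    (D D' : Matrix (Fin m) (Fin m) S) :
    bordered a y x D - bordered a' y' x' D' = bordered (a - a') (y - y') (x - x') (D - D') := by
  ext p q
  refine p.cases ?_ fun p => ?_ <;> refine q.cases ?_ fun q => ?_ <;> simp [bordered]

theorem one_eq_bordered [Zero S] [One S] (m : ℕ) :
    (1 : Matrix (Fin (m + 1)) (Fin (m + 1)) S) = bordered 1 0 0 1 := by
  ext p q
  refine p.cases ?_ fun p => ?_ <;> refine q.cases ?_ fun q => ?_ <;>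
    simp [bordered, Matrix.one_apply, Fin.succ_ne_zero, (Fin.succ_ne_zero _).symm]

theorem bordered_mul [Semiring S] {m : ℕ} (a a' : S) (y x y' x' : Fin m → S)
    (D D' : Matrix (Fin m) (Fin m) S) :
    bordered a y x D * bordered a' y' x' D' =
      bordered (a * a' + y ⬝ᵥ x') (a • y' + Matrix.vecMul y D')
        (MulOpposite.op a' • x + Matrix.mulVec D x') (Matrix.vecMulVec x y' + D * D') := by
  ext p q
  refine p.cases ?_ fun p => ?_ <;> refine q.cases ?_ fun q => ?_ <;>
    simp [bordered, Matrix.mul_apply, Fin.sum_univ_succ, dotProduct, Matrix.vecMul, Matrix.mulVec,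
      Matrix.vecMulVec_apply]

theorem bordered_mulVec_cons_zero [Semiring S] {m : ℕ} (a : S) (y x v : Fin m → S)
    (D : Matrix (Fin m) (Fin m) S) :
    Matrix.mulVec (bordered a y x D) (Fin.cons 0 v) = Fin.cons (y ⬝ᵥ v) (Matrix.mulVec D v) := by
  ext p
  refine p.cases ?_ fun p => ?_ <;>
    simp [bordered, Matrix.mulVec, dotProduct, Fin.sum_univ_succ]

theorem vecMul_cons_zero_bordered [Semiring S] {m : ℕ} (a : S) (y x v : Fin m → S)
    (D : Matrix (Fin m) (Fin m) S) :
    Matrix.vecMul (Fin.cons 0 v) (bordered a y x D) = Fin.cons (v ⬝ᵥ x) (Matrix.vecMul v D) := by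
  ext p
  refine p.cases ?_ fun p => ?_ <;>
    simp [bordered, Matrix.vecMul, dotProduct, Fin.sum_univ_succ]

theorem isUnit_bordered_diag [Semiring S] {m : ℕ} {a : S} {D : Matrix (Fin m) (Fin m) S}
    (ha : IsUnit a) (hD : IsUnit D) : IsUnit (bordered a 0 0 D) := by
  obtain ⟨a, rfl⟩ := ha
  obtain ⟨D, rfl⟩ := hD
  exact ⟨⟨bordered a 0 0 D, bordered ↑a⁻¹ 0 0 ↑D⁻¹,
    by simp [bordered_mul, one_eq_bordered], by simp [bordered_mul, one_eq_bordered]⟩, rfl⟩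

theorem isUnit_bordered_lower [Ring S] {m : ℕ} (x : Fin m → S) : IsUnit (bordered 1 0 x 1) :=
  ⟨⟨bordered 1 0 x 1, bordered 1 0 (-x) 1,
    by simp [bordered_mul, one_eq_bordered], by simp [bordered_mul, one_eq_bordered]⟩, rfl⟩

theorem isUnit_bordered_upper [Ring S] {m : ℕ} (y : Fin m → S) : IsUnit (bordered 1 y 0 1) :=
  ⟨⟨bordered 1 y 0 1, bordered 1 (-y) 0 1,
    by simp [bordered_mul, one_eq_bordered], by simp [bordered_mul, one_eq_bordered]⟩, rfl⟩

theorem bordered_schur_complement [Ring S] {m : ℕ} (y x : Fin m → S)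
    (U D V : Matrix (Fin m) (Fin m) S) :
    bordered (-1) 0 0 U * bordered 1 0 x 1 * bordered (-1) y x D *
      (bordered 1 y 0 1 * bordered 1 0 0 V) =
      bordered 1 0 0 (U * (D + Matrix.vecMulVec x y) * V) := by
  simp only [bordered_mul]
  simp [Matrix.mul_add, Matrix.add_mul, Matrix.mul_vecMulVec, Matrix.neg_vecMul, add_comm]

theorem single_last_succ [Zero S] [One S] (m : ℕ) :
    (Pi.single (Fin.last (m + 1)) 1 : Fin (m + 2) → S) =
      Fin.cons 0 (Pi.single (Fin.last m) 1) := by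
  ext p
  refine p.cases ?_ fun p => ?_
  · simp [Fin.ext_iff]
  · simp [Pi.single_apply, ← Fin.succ_last]

theorem vecMulVec_single_single {ι κ : Type*} [DecidableEq ι] [DecidableEq κ]
    [NonUnitalNonAssocSemiring S] (i : ι) (j : κ) (a b : S) :
    Matrix.vecMulVec (Pi.single i a) (Pi.single j b) = Matrix.single i j (a * b) := by
  ext p q
  simp only [Matrix.single_apply, Matrix.vecMulVec_apply, Pi.single_apply, ite_mul, mul_ite,
    zero_mul, mul_zero]
  grind

end Bordered

section ElementaryBlocks

variable {S : Type*}

/-- The diagonal matrix `diag(W, 1, …, 1)` of size `m`; the block form of `M_{-m}(W)`. -/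
def blockDiagFirst [Zero S] [One S] (m : ℕ) (W : S) : Matrix (Fin m) (Fin m) S :=
  Matrix.diagonal fun p => if (p : ℕ) = 0 then W else 1

/-- The diagonal matrix `diag(1, …, 1, W)` of size `m`; the block form of `M_0(W)`. -/
def blockDiagLast [Zero S] [One S] (m : ℕ) (W : S) : Matrix (Fin m) (Fin m) S :=
  Matrix.diagonal fun p => if (p : ℕ) + 1 = m then W else 1

/-- The identity matrix of size `m` with the pattern `[0, 1; 1, W]` inserted in the rows and columns
`m - i - 1` and `m - i`; the block form of `M_{-i}(W)`, meaningful for `1 ≤ i < m`. -/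
def swapBlock [Zero S] [One S] (m i : ℕ) (W : S) : Matrix (Fin m) (Fin m) S :=
  Matrix.of fun p q =>
    if (p : ℕ) + i + 1 = m ∧ (q : ℕ) + i + 1 = m then 0
    else if (p : ℕ) + i + 1 = m ∧ (q : ℕ) + i = m then 1
    else if (p : ℕ) + i = m ∧ (q : ℕ) + i + 1 = m then 1
    else if (p : ℕ) + i = m ∧ (q : ℕ) + i = m then W
    else if p = q then 1 else 0

theorem blockDiagFirst_succ [Zero S] [One S] (m : ℕ) (W : S) :
    blockDiagFirst (m + 1) W = bordered W 0 0 1 := by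
  ext p q
  refine p.cases ?_ fun p => ?_ <;> refine q.cases ?_ fun q => ?_ <;>
    simp [bordered, blockDiagFirst, Matrix.diagonal_apply, Matrix.one_apply, Fin.succ_ne_zero,
      (Fin.succ_ne_zero _).symm]

theorem blockDiagLast_succ [Zero S] [One S] (m : ℕ) (W : S) :
    blockDiagLast (m + 2) W = bordered 1 0 0 (blockDiagLast (m + 1) W) := by
  ext p q
  refine p.cases ?_ fun p => ?_ <;> refine q.cases ?_ fun q => ?_ <;>
    simp [bordered, blockDiagLast, Matrix.diagonal_apply, Fin.succ_ne_zero,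
      (Fin.succ_ne_zero _).symm]

theorem swapBlock_top [Zero S] [One S] (m : ℕ) (W : S) :
    swapBlock (m + 2) (m + 1) W =
      bordered 0 (Pi.single 0 1) (Pi.single 0 1) (blockDiagFirst (m + 1) W) := by
  ext p q
  refine p.cases ?_ fun p => ?_ <;> refine q.cases ?_ fun q => ?_ <;>
  · simp only [bordered, swapBlock, blockDiagFirst, Matrix.diagonal_apply, Fin.ext_iff,
      Matrix.of_apply, Fin.cons_succ, Fin.cons_zero, Fin.val_succ, Fin.val_zero, Pi.single_apply]
    split_ifs <;> first | rfl | contradiction | omega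

theorem swapBlock_succ [Zero S] [One S] {m i : ℕ} (hi : i ≤ m) (W : S) :
    swapBlock (m + 2) i W = bordered 1 0 0 (swapBlock (m + 1) i W) := by
  ext p q
  refine p.cases ?_ fun p => ?_ <;> refine q.cases ?_ fun q => ?_ <;>
  · simp only [bordered, swapBlock, Fin.ext_iff, Matrix.of_apply, Fin.cons_succ, Fin.cons_zero,
      Fin.val_succ, Fin.val_zero, Pi.zero_apply]
    split_ifs <;> first | rfl | contradiction | omega

theorem blockDiagFirst_add [AddMonoidWithOne S] (m : ℕ) (W Z : S) :
    blockDiagFirst (m + 1) (W + Z) = blockDiagFirst (m + 1) W + Matrix.single 0 0 Z := by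
  rw [← Matrix.diagonal_single, blockDiagFirst, blockDiagFirst, Matrix.diagonal_add]
  congr 1
  ext p
  by_cases hp : p = 0 <;> simp [hp]

theorem blockDiagLast_add [AddMonoidWithOne S] (m : ℕ) (W Z : S) :
    blockDiagLast (m + 1) (W + Z) =
      blockDiagLast (m + 1) W + Matrix.single (Fin.last m) (Fin.last m) Z := by
  rw [← Matrix.diagonal_single, blockDiagLast, blockDiagLast, Matrix.diagonal_add]
  congr 1
  ext p
  by_cases hp : p = Fin.last m
  · simp [hp]
  · simp [hp, mt (fun h : (p : ℕ) = m => Fin.ext h) hp]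

theorem blockDiagLast_mul [Semiring S] (m : ℕ) (W Z : S) :
    blockDiagLast m W * blockDiagLast m Z = blockDiagLast m (W * Z) := by
  rw [blockDiagLast, blockDiagLast, Matrix.diagonal_mul_diagonal, blockDiagLast]
  congr 1
  ext p
  split_ifs <;> simp

theorem isUnit_diagonal [Semiring S] {ι : Type*} [Fintype ι] [DecidableEq ι] {d : ι → S}
    (hd : ∀ i, IsUnit (d i)) : IsUnit (Matrix.diagonal d) :=
  (Pi.isUnit_iff.2 hd).map (Matrix.diagonalRingHom ι S)

theorem isUnit_blockDiagFirst [Semiring S] (m : ℕ) {W : S} (hW : IsUnit W) :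
    IsUnit (blockDiagFirst m W) :=
  isUnit_diagonal fun p => by split_ifs <;> simp [hW]

theorem isUnit_blockDiagLast [Semiring S] (m : ℕ) {W : S} (hW : IsUnit W) :
    IsUnit (blockDiagLast m W) :=
  isUnit_diagonal fun p => by split_ifs <;> simp [hW]

/-- The product of the matrices `swapBlock m i (A i)` over an index list. -/
def swapProd [Semiring S] (m : ℕ) (A : ℕ → S) (l : List ℕ) : Matrix (Fin m) (Fin m) S :=
  (l.map fun i => swapBlock m i (A i)).prod

theorem swapProd_cons [Semiring S] (m : ℕ) (A : ℕ → S) (i : ℕ) (l : List ℕ) :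
    swapProd m A (i :: l) = swapBlock m i (A i) * swapProd m A l := by
  simp [swapProd]

theorem swapProd_append [Semiring S] (m : ℕ) (A : ℕ → S) (l l' : List ℕ) :
    swapProd m A (l ++ l') = swapProd m A l * swapProd m A l' := by
  simp [swapProd]

theorem swapProd_succ [Semiring S] {m : ℕ} (A : ℕ → S) {l : List ℕ} (hl : ∀ i ∈ l, i ≤ m) :
    swapProd (m + 2) A l = bordered 1 0 0 (swapProd (m + 1) A l) := by
  induction l with
  | nil => simp [swapProd, one_eq_bordered (m + 1)]
  | cons i l ih =>
    rw [swapProd_cons, swapProd_cons, ih fun j hj => hl j (List.mem_cons_of_mem _ hj),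
      swapBlock_succ (hl i List.mem_cons_self), bordered_mul]
    simp

/-- The constant factor multiplying `α` in a Fiedler pencil: a product of `swapBlock`s with the
factor `diag(W, 1, …, 1)` of index `m` in between. -/
def fiedlerProd [Semiring S] (m : ℕ) (A : ℕ → S) (l : List ℕ) (W : S) (l' : List ℕ) :
    Matrix (Fin m) (Fin m) S :=
  swapProd m A l * blockDiagFirst m W * swapProd m A l'

theorem fiedlerProd_top_left [Semiring S] {m : ℕ} (A : ℕ → S) (W : S) {l₁ l₂ l' : List ℕ}
    (hl : ∀ i ∈ l₁ ++ (l₂ ++ l'), i ≤ m) :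
    fiedlerProd (m + 2) A (l₁ ++ (m + 1) :: l₂) W l' =
      bordered 0 (Matrix.vecMul (Pi.single 0 1) (swapProd (m + 1) A (l₂ ++ l')))
        (Matrix.mulVec (swapProd (m + 1) A l₁) (Pi.single 0 W))
        (fiedlerProd (m + 1) A l₁ (A (m + 1)) (l₂ ++ l')) := by
  simp only [List.forall_mem_append] at hl
  obtain ⟨h₁, h₂, h'⟩ := hl
  rw [fiedlerProd, swapProd_append, swapProd_cons, swapProd_succ A h₁, swapProd_succ A h₂,
    swapProd_succ A h', swapBlock_top, blockDiagFirst_succ (m + 1), swapProd_append (m + 1) A l₂,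
    ← Matrix.vecMul_vecMul]
  simp [bordered_mul, fiedlerProd, swapProd_append, Matrix.mul_assoc]

theorem fiedlerProd_top_right [Semiring S] {m : ℕ} (A : ℕ → S) (W : S) {l l₁ l₂ : List ℕ}
    (hl : ∀ i ∈ l ++ l₁ ++ l₂, i ≤ m) :
    fiedlerProd (m + 2) A l W (l₁ ++ (m + 1) :: l₂) =
      bordered 0 (Matrix.vecMul (Pi.single 0 W) (swapProd (m + 1) A l₂))
        (Matrix.mulVec (swapProd (m + 1) A (l ++ l₁)) (Pi.single 0 1))
        (fiedlerProd (m + 1) A (l ++ l₁) (A (m + 1)) l₂) := by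
  simp only [List.forall_mem_append] at hl
  obtain ⟨⟨h, h₁⟩, h₂⟩ := hl
  rw [fiedlerProd, swapProd_append, swapProd_cons, swapProd_succ A h, swapProd_succ A h₁,
    swapProd_succ A h₂, swapBlock_top, blockDiagFirst_succ (m + 1), swapProd_append (m + 1) A l,
    ← Matrix.mulVec_mulVec]
  simp [bordered_mul, fiedlerProd, swapProd_append, Matrix.mul_assoc]

theorem perm_range'_of_perm_range'_succ {k k' : List ℕ} {m : ℕ}
    (h : (k ++ (m + 1) :: k').Perm (List.range' 1 (m + 1))) :
    (k ++ k').Perm (List.range' 1 m) := by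
  rw [List.range'_1_concat, add_comm 1 m] at h
  exact (List.perm_middle.symm.trans (h.trans (List.perm_append_singleton _ _))).cons_inv

theorem exists_fiedlerProd_eq_bordered [Semiring S] {m : ℕ} (A : ℕ → S) (W : S) {l l' : List ℕ}
    (hl : (l ++ l').Perm (List.range' 1 (m + 1))) :
    ∃ (k k' : List ℕ) (a b : S), (k ++ k').Perm (List.range' 1 m) ∧ a * b = W ∧
      fiedlerProd (m + 2) A l W l' =
        bordered 0 (Matrix.vecMul (Pi.single 0 b) (swapProd (m + 1) A k'))
          (Matrix.mulVec (swapProd (m + 1) A k) (Pi.single 0 a))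
          (fiedlerProd (m + 1) A k (A (m + 1)) k') := by
  have le_of_mem {k : List ℕ} (h : k.Perm (List.range' 1 m)) : ∀ i ∈ k, i ≤ m := fun i hi => by
    have := List.mem_range'_1.1 (h.mem_iff.1 hi)
    omega
  have top_mem : m + 1 ∈ l ++ l' := by simp [hl.mem_iff, List.mem_range'_1, add_comm 1]
  rcases List.mem_append.1 top_mem with h | h <;> obtain ⟨k₁, k₂, rfl⟩ := List.append_of_mem h
  · have hk : (k₁ ++ (k₂ ++ l')).Perm (List.range' 1 m) :=
      perm_range'_of_perm_range'_succ (by simpa using hl)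
    exact ⟨k₁, k₂ ++ l', W, 1, hk, mul_one W, fiedlerProd_top_left A W (le_of_mem hk)⟩
  · have hk : (l ++ k₁ ++ k₂).Perm (List.range' 1 m) :=
      perm_range'_of_perm_range'_succ (by simpa using hl)
    exact ⟨l ++ k₁, k₂, 1, W, hk, one_mul W, fiedlerProd_top_right A W (le_of_mem hk)⟩

end ElementaryBlocks

section Equivalence

/-- Equivalence of matrices, in an arbitrary monoid: `b = u a v` with units `u`, `v`. -/
def IsEquivalent {M : Type*} [Monoid M] (a b : M) : Prop :=
  ∃ u v : Mˣ, u * a * v = b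

namespace IsEquivalent

variable {M : Type*} [Monoid M] {a b c : M}

theorem of_mul {u v : M} (hu : IsUnit u) (hv : IsUnit v) (h : u * a * v = b) :
    IsEquivalent a b := by
  obtain ⟨u, rfl⟩ := hu
  obtain ⟨v, rfl⟩ := hv
  exact ⟨u, v, h⟩

theorem trans (hab : IsEquivalent a b) (hbc : IsEquivalent b c) : IsEquivalent a c := by
  obtain ⟨u, v, rfl⟩ := hab
  obtain ⟨u', v', rfl⟩ := hbc
  exact ⟨u' * u, v * v', by simp [mul_assoc]⟩

instance : Trans (IsEquivalent (M := M)) IsEquivalent IsEquivalent := ⟨trans⟩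

theorem map {N F : Type*} [Monoid N] [FunLike F M N] [MonoidHomClass F M N]
    (h : IsEquivalent a b) (f : F) : IsEquivalent (f a) (f b) := by
  obtain ⟨u, v, rfl⟩ := h
  exact ⟨Units.map (f : M →* N) u, Units.map (f : M →* N) v, by simp⟩

end IsEquivalent

end Equivalence

section Reduction

variable {S : Type*} [Ring S]

/-- `U` and `V` reduce `M - diag(1, …, 1, 0)` to `diag(1, …, 1, W)`. Since `U` and `Vᵀ` fix the last
basis vector, they then reduce `M - diag(1, …, 1, Z)` for every `Z`, and they remain usable after
`M` has been augmented by a last row and a last column. -/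
structure IsReduction {m : ℕ} (M : Matrix (Fin (m + 1)) (Fin (m + 1)) S) (W : S)
    (U V : Matrix (Fin (m + 1)) (Fin (m + 1)) S) : Prop where
  isUnit_left : IsUnit U
  isUnit_right : IsUnit V
  mulVec_last : Matrix.mulVec U (Pi.single (Fin.last m) 1) = Pi.single (Fin.last m) 1
  last_vecMul : Matrix.vecMul (Pi.single (Fin.last m) 1) V = Pi.single (Fin.last m) 1
  mul_mul : U * (M - blockDiagLast (m + 1) 0) * V = blockDiagLast (m + 1) W

theorem IsReduction.mul_sub_mul {m : ℕ} {M U V : Matrix (Fin (m + 1)) (Fin (m + 1)) S} {W : S}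
    (h : IsReduction M W U V) (Z : S) :
    U * (M - blockDiagLast (m + 1) Z) * V = blockDiagLast (m + 1) (W - Z) := by
  have single_eq : Matrix.single (Fin.last m) (Fin.last m) Z =
      Matrix.vecMulVec (Pi.single (Fin.last m) 1) (Z • Pi.single (Fin.last m) (1 : S)) := by
    rw [← Pi.single_smul, vecMulVec_single_single, one_mul, smul_eq_mul, mul_one]
  have mul_single_mul : U * Matrix.single (Fin.last m) (Fin.last m) Z * V =
      Matrix.single (Fin.last m) (Fin.last m) Z := by
    rw [single_eq, Matrix.mul_vecMulVec, Matrix.vecMulVec_mul, h.mulVec_last, Matrix.smul_vecMul,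
      h.last_vecMul]
  calc U * (M - blockDiagLast (m + 1) Z) * V
      = U * (M - blockDiagLast (m + 1) 0) * V -
          U * Matrix.single (Fin.last m) (Fin.last m) Z * V := by
        rw [← Matrix.sub_mul, ← Matrix.mul_sub, sub_sub, ← blockDiagLast_add, zero_add]
    _ = blockDiagLast (m + 1) (W - Z) := by
        rw [h.mul_mul, mul_single_mul, sub_eq_iff_eq_add, ← blockDiagLast_add, sub_add_cancel]

theorem IsReduction.isEquivalent {m : ℕ} {M U V : Matrix (Fin (m + 1)) (Fin (m + 1)) S} {W : S}
    (h : IsReduction M W U V) (Z : S) :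
    IsEquivalent (M - blockDiagLast (m + 1) Z) (blockDiagLast (m + 1) (W - Z)) :=
  .of_mul h.isUnit_left h.isUnit_right (h.mul_sub_mul Z)

theorem IsReduction.bordered {m : ℕ} {M U V : Matrix (Fin (m + 1)) (Fin (m + 1)) S} {W : S}
    {x y : Fin (m + 1) → S} (h : IsReduction (M + Matrix.vecMulVec x y) W U V) :
    IsReduction (bordered 0 y x M) W (bordered (-1) 0 0 U * bordered 1 0 x 1)
      (bordered 1 y 0 1 * bordered 1 0 0 V) where
  isUnit_left := (isUnit_bordered_diag isUnit_one.neg h.isUnit_left).mul (isUnit_bordered_lower x)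
  isUnit_right := (isUnit_bordered_upper y).mul (isUnit_bordered_diag isUnit_one h.isUnit_right)
  mulVec_last := by
    rw [← Matrix.mulVec_mulVec, single_last_succ, bordered_mulVec_cons_zero, zero_dotProduct,
      bordered_mulVec_cons_zero, zero_dotProduct, Matrix.one_mulVec, h.mulVec_last]
  last_vecMul := by
    rw [← Matrix.vecMul_vecMul, single_last_succ, vecMul_cons_zero_bordered, dotProduct_zero,
      vecMul_cons_zero_bordered, dotProduct_zero, Matrix.vecMul_one, h.last_vecMul]
  mul_mul := by
    rw [blockDiagLast_succ, blockDiagLast_succ, bordered_sub, zero_sub, sub_zero, sub_zero,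
      bordered_schur_complement, sub_add_eq_add_sub, h.mul_mul]

variable {K : Type*} [CommSemiring K] [Algebra K S]

/-- The Schur complement of the first corner of a Fiedler pencil is the Fiedler pencil with
one index less in which `A (m + 1)` is replaced by `A (m + 1) + α W`, as in Horner's scheme. -/
theorem exists_isReduction_fiedlerProd (α : K) (A : ℕ → S) {m : ℕ} (W : S) {l l' : List ℕ}
    (hl : (l ++ l').Perm (List.range' 1 m)) :
    ∃ U V, IsReduction (α • fiedlerProd (m + 1) A l W l')
      (∑ j ∈ Finset.range m, α ^ (j + 1) • A (j + 1) + α ^ (m + 1) • W) U V := by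
  induction m generalizing W l l' with
  | zero =>
    obtain ⟨rfl, rfl⟩ : l = [] ∧ l' = [] := List.append_eq_nil_iff.1 hl.eq_nil
    refine ⟨1, 1, isUnit_one, isUnit_one, Matrix.one_mulVec _, Matrix.vecMul_one _, ?_⟩
    ext p q
    simp [Fin.fin_one_eq_zero p, Fin.fin_one_eq_zero q, fiedlerProd, swapProd, blockDiagFirst,
      blockDiagLast]
  | succ m ih =>
    obtain ⟨k, k', a, b, hk, rfl, hprod⟩ := exists_fiedlerProd_eq_bordered A W hl
    obtain ⟨U, V, hUV⟩ := ih (A (m + 1) + α • (a * b)) hk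
    rw [hprod, smul_bordered, smul_zero]
    refine ⟨_, _, IsReduction.bordered (U := U) (V := V) ?_⟩
    convert hUV using 1
    · rw [fiedlerProd, fiedlerProd, blockDiagFirst_add, ← Matrix.smul_single,
        ← vecMulVec_single_single, Matrix.mul_add, Matrix.add_mul, smul_add, Matrix.mul_smul,
        Matrix.smul_mul, Matrix.mul_vecMulVec, Matrix.vecMulVec_mul, Matrix.smul_vecMulVec,
        Matrix.vecMulVec_smul]
    · rw [Finset.sum_range_succ, smul_add, smul_smul, ← pow_succ, add_assoc]

end Reduction

section Reversal

variable {S : Type*}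

theorem swapBlock_eq_swap_add_single [Semiring S] {m i : ℕ} {a b : Fin m}
    (ha : (a : ℕ) + i + 1 = m) (hb : (b : ℕ) + i = m) (W : S) :
    swapBlock m i W = Matrix.swap S a b + Matrix.single b b W := by
  ext p q
  simp only [swapBlock, Matrix.swap, Matrix.of_apply, Matrix.add_apply, Matrix.single_apply,
    PEquiv.toMatrix_apply, Equiv.toPEquiv_apply, Option.mem_some_iff, Equiv.swap_apply_def,
    Fin.ext_iff]
  grind

/-- Reversal of the order of the block rows and of the block columns. -/
def blockRev [Semiring S] (m : ℕ) : Matrix (Fin m) (Fin m) S ≃+* Matrix (Fin m) (Fin m) S :=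
  (Matrix.reindexAlgEquiv ℕ S Fin.revPerm).toRingEquiv

theorem blockRev_apply [Semiring S] {m : ℕ} (M : Matrix (Fin m) (Fin m) S) (p q : Fin m) :
    blockRev m M p q = M p.rev q.rev :=
  rfl

theorem blockRev_blockRev [Semiring S] {m : ℕ} (M : Matrix (Fin m) (Fin m) S) :
    blockRev m (blockRev m M) = M := by
  ext p q
  simp only [blockRev_apply, Fin.rev_rev]

theorem isEquivalent_blockRev [Semiring S] {m : ℕ} (M : Matrix (Fin m) (Fin m) S) :
    IsEquivalent (blockRev m M) M := by
  have isUnit_rev : IsUnit (Fin.revPerm.toPEquiv.toMatrix : Matrix (Fin m) (Fin m) S) := by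
    have rev_mul_rev : (Fin.revPerm.toPEquiv.toMatrix * Fin.revPerm.toPEquiv.toMatrix :
        Matrix (Fin m) (Fin m) S) = 1 := by
      rw [PEquiv.toMatrix_toPEquiv_mul]
      ext p q
      simp [PEquiv.toMatrix_apply, Matrix.one_apply]
    exact ⟨⟨_, _, rev_mul_rev, rev_mul_rev⟩, rfl⟩
  refine .of_mul isUnit_rev isUnit_rev ?_
  rw [PEquiv.toMatrix_toPEquiv_mul, PEquiv.mul_toMatrix_toPEquiv]
  exact blockRev_blockRev M

theorem blockRev_blockDiagFirst [Semiring S] (m : ℕ) (W : S) :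
    blockRev m (blockDiagFirst m W) = blockDiagLast m W := by
  ext p q
  have := p.2
  simp only [blockRev_apply, blockDiagFirst, blockDiagLast, Matrix.diagonal_apply, Fin.rev_inj,
    Fin.val_rev]
  grind

theorem blockRev_blockDiagLast [Semiring S] (m : ℕ) (W : S) :
    blockRev m (blockDiagLast m W) = blockDiagFirst m W := by
  rw [← blockRev_blockDiagFirst, blockRev_blockRev]

theorem blockRev_smul [Semiring S] {K : Type*} [SMul K S] {m : ℕ} (c : K)
    (M : Matrix (Fin m) (Fin m) S) : blockRev m (c • M) = c • blockRev m M :=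
  rfl

theorem blockRev_swapBlock [Semiring S] {m i : ℕ} {a b : Fin m}
    (ha : (a : ℕ) + i + 1 = m) (hb : (b : ℕ) + i = m) (W : S) :
    blockRev m (swapBlock m (m - i) W) = Matrix.swap S a b + Matrix.single a a W := by
  have hab : (b.rev : ℕ) + (m - i) + 1 = m ∧ (a.rev : ℕ) + (m - i) = m := by
    simp only [Fin.val_rev]
    omega
  rw [swapBlock_eq_swap_add_single hab.1 hab.2]
  ext p q
  simp only [blockRev_apply, Matrix.swap, Matrix.add_apply, Matrix.single_apply,
    PEquiv.toMatrix_apply, Equiv.toPEquiv_apply, Option.mem_some_iff, Equiv.swap_apply_def,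
    Fin.rev_inj]
  grind [Fin.rev_inj]

variable [Ring S]

theorem swapBlock_mul_blockRev {m i : ℕ} (hi : 1 ≤ i) (him : i < m) (W : S) :
    swapBlock m i W * blockRev m (swapBlock m (m - i) (-W)) = 1 := by
  obtain ⟨a, ha⟩ : ∃ a : Fin m, (a : ℕ) + i + 1 = m := ⟨⟨m - i - 1, by omega⟩, by grind⟩
  obtain ⟨b, hb⟩ : ∃ b : Fin m, (b : ℕ) + i = m := ⟨⟨m - i, by omega⟩, by grind⟩
  have hab : a ≠ b := by grind
  have single_mul_swap : Matrix.single b b W * Matrix.swap S a b = Matrix.single b a W := by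
    rw [Matrix.swap, PEquiv.mul_toMatrix_toPEquiv]
    simpa using Matrix.submatrix_single_equiv (Equiv.refl _) (Equiv.swap a b) b b W
  have swap_mul_single : Matrix.swap S a b * Matrix.single a a (-W) = Matrix.single b a (-W) := by
    rw [Matrix.swap, PEquiv.toMatrix_toPEquiv_mul]
    simpa using Matrix.submatrix_single_equiv (Equiv.swap a b) (Equiv.refl _) a a (-W)
  rw [swapBlock_eq_swap_add_single ha hb, blockRev_swapBlock ha hb, add_mul, mul_add,
    mul_add, Matrix.swap_mul_self, single_mul_swap, swap_mul_single,
    Matrix.single_mul_single_of_ne _ _ _ _ hab.symm]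
  simp [add_assoc, ← Matrix.single_add]

theorem blockRev_mul_swapBlock {m i : ℕ} (hi : 1 ≤ i) (him : i < m) (W : S) :
    blockRev m (swapBlock m (m - i) (-W)) * swapBlock m i W = 1 := by
  have h := congrArg (blockRev m) (swapBlock_mul_blockRev (i := m - i) (by omega) (by omega) (-W))
  rwa [map_mul, blockRev_blockRev, map_one, neg_neg, Nat.sub_sub_self him.le] at h

/-- The index list `i ↦ m - i` in reversed order. It describes the inverse of a product of
elementary blocks, see `swapProd_mul_blockRev`. -/
def reflectIndices (m : ℕ) (l : List ℕ) : List ℕ :=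
  (l.map (m - ·)).reverse

theorem perm_reflectIndices_append {m : ℕ} {l l' : List ℕ}
    (hl : (l ++ l').Perm (List.range' 1 m)) :
    (reflectIndices (m + 1) l ++ reflectIndices (m + 1) l').Perm (List.range' 1 m) := by
  have hmap : (reflectIndices (m + 1) l ++ reflectIndices (m + 1) l').Perm
      ((l ++ l').map (m + 1 - ·)) := by
    rw [List.map_append]
    exact (List.reverse_perm _).append (List.reverse_perm _)
  have hnodup : ((List.range' 1 m).map (m + 1 - ·)).Nodup := by
    refine List.Nodup.map_on (fun i hi j hj hij => ?_) List.nodup_range'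
    simp only [List.mem_range'_1] at hi hj
    omega
  refine hmap.trans ((hl.map _).trans ?_)
  rw [List.perm_ext_iff_of_nodup hnodup List.nodup_range']
  intro i
  simp only [List.mem_map, List.mem_range'_1]
  exact ⟨by rintro ⟨j, hj, rfl⟩; omega, fun hi => ⟨m + 1 - i, by omega, by omega⟩⟩

theorem swapProd_mul_blockRev {m : ℕ} (A : ℕ → S) {l : List ℕ} (hl : ∀ i ∈ l, 1 ≤ i ∧ i < m) :
    swapProd m A l * blockRev m (swapProd m (fun i => -A (m - i)) (reflectIndices m l)) = 1 ∧
      blockRev m (swapProd m (fun i => -A (m - i)) (reflectIndices m l)) * swapProd m A l = 1 := by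
  induction l with
  | nil => simp [swapProd, reflectIndices]
  | cons i l ih =>
    obtain ⟨hi, him⟩ := hl i List.mem_cons_self
    obtain ⟨ih₁, ih₂⟩ := ih fun j hj => hl j (List.mem_cons_of_mem _ hj)
    have hA : A (m - (m - i)) = A i := by rw [Nat.sub_sub_self him.le]
    have hcons : swapProd m (fun i => -A (m - i)) (reflectIndices m (i :: l)) =
        swapProd m (fun i => -A (m - i)) (reflectIndices m l) * swapBlock m (m - i) (-A i) := by
      simp [swapProd, reflectIndices, hA]
    rw [hcons, map_mul, swapProd_cons]
    constructor
    · rw [mul_assoc, ← mul_assoc (swapProd m A l), ih₁, one_mul, swapBlock_mul_blockRev hi him]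
    · rw [mul_assoc, ← mul_assoc (blockRev m (swapBlock m _ _)), blockRev_mul_swapBlock hi him,
        one_mul, ih₂]

variable {K : Type*} [CommSemiring K] [Algebra K S]

theorem isEquivalent_fiedlerProd_sub_smul (α : K) (A : ℕ → S) {m : ℕ} (W Z : S) {l l' : List ℕ}
    (hl : (l ++ l').Perm (List.range' 1 m)) :
    IsEquivalent (fiedlerProd (m + 1) A l W l' - α • blockDiagLast (m + 1) Z)
      (blockDiagLast (m + 1)
        (W + ∑ j ∈ Finset.range m, α ^ (j + 1) • A (m - j) - α ^ (m + 1) • Z)) := by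
  have hlt : ∀ i ∈ l ++ l', 1 ≤ i ∧ i < m + 1 := fun i hi => by
    have := List.mem_range'_1.1 (hl.mem_iff.1 hi)
    omega
  obtain ⟨X_mul_inv, inv_mul_X⟩ :=
    swapProd_mul_blockRev A fun i hi => hlt i (List.mem_append_left l' hi)
  obtain ⟨Y_mul_inv, inv_mul_Y⟩ :=
    swapProd_mul_blockRev A fun i hi => hlt i (List.mem_append_right l hi)
  set B : ℕ → S := fun i => -A (m + 1 - i) with hB
  set F := fiedlerProd (m + 1) B (reflectIndices (m + 1) l) Z (reflectIndices (m + 1) l') with hF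
  obtain ⟨U, V, hUV⟩ := exists_isReduction_fiedlerProd α B Z (perm_reflectIndices_append hl)
  have isUnit_neg_last : IsUnit (blockDiagLast (m + 1) (-1 : S)) :=
    isUnit_blockDiagLast (m + 1) isUnit_one.neg
  calc
    IsEquivalent (fiedlerProd (m + 1) A l W l' - α • blockDiagLast (m + 1) Z)
        (blockRev (m + 1) (blockDiagLast (m + 1) W - α • F)) := by
      refine .of_mul ⟨⟨_, _, inv_mul_X, X_mul_inv⟩, rfl⟩ ⟨⟨_, _, inv_mul_Y, Y_mul_inv⟩, rfl⟩ ?_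
      rw [map_sub, blockRev_smul, hF, fiedlerProd, fiedlerProd, map_mul, map_mul,
        blockRev_blockDiagFirst, blockRev_blockDiagLast, mul_sub, sub_mul, mul_smul_comm,
        smul_mul_assoc, ← mul_assoc, ← mul_assoc, inv_mul_X, one_mul, mul_assoc, Y_mul_inv,
        mul_one]
    IsEquivalent _ (blockDiagLast (m + 1) W - α • F) := isEquivalent_blockRev _
    IsEquivalent _ (α • F - blockDiagLast (m + 1) W) :=
      .of_mul isUnit_one.neg isUnit_one (by simp)
    IsEquivalent _ (blockDiagLast (m + 1) _) := hUV.isEquivalent W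
    IsEquivalent _ _ := by
      refine .of_mul isUnit_neg_last isUnit_one ?_
      rw [mul_one, blockDiagLast_mul]
      simp only [hB, Nat.add_sub_add_right, smul_neg, Finset.sum_neg_distrib, neg_one_mul]
      congr 1
      abel

end Reversal

section ProperRational

open Filter

variable {𝕜 : Type*} [NontriviallyNormedField 𝕜]

/-- The rational function `f` converges to `d` at infinity. -/
def HasLimitAtInfty (f : RatFunc 𝕜) (d : 𝕜) : Prop :=
  Tendsto (fun z : 𝕜 => f.eval (RingHom.id 𝕜) z) (Bornology.cobounded 𝕜) (nhds d)

theorem eventually_eval₂_ne_zero {p : 𝕜[X]} (hp : p ≠ 0) :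
    ∀ᶠ z in Bornology.cobounded 𝕜, p.eval₂ (RingHom.id 𝕜) z ≠ 0 := by
  have hfin : {z : 𝕜 | p.IsRoot z}.Finite := Polynomial.finite_setOfPred_isRoot hp
  filter_upwards [Bornology.isBounded_def.1 hfin.isBounded] with z hz
  simpa using hz

theorem eventually_eval_inv {f : RatFunc 𝕜} (hf : f ≠ 0) :
    ∀ᶠ z in Bornology.cobounded 𝕜,
      (f.eval (RingHom.id 𝕜) z)⁻¹ = f⁻¹.eval (RingHom.id 𝕜) z := by
  filter_upwards [eventually_eval₂_ne_zero f.denom_ne_zero,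
    eventually_eval₂_ne_zero f⁻¹.denom_ne_zero] with z hz hz'
  have h := RatFunc.eval_mul _ _ hz hz'
  rw [mul_inv_cancel₀ hf, RatFunc.eval_one] at h
  exact inv_eq_of_mul_eq_one_right h.symm

theorem hasLimitAtInfty_C (c : 𝕜) : HasLimitAtInfty (RatFunc.C c) c := by
  simp [HasLimitAtInfty]

theorem hasLimitAtInfty_inv_X : HasLimitAtInfty (RatFunc.X : RatFunc 𝕜)⁻¹ 0 := by
  refine (tendsto_inv₀_cobounded (α := 𝕜)).congr' ?_
  filter_upwards [eventually_eval_inv (RatFunc.X_ne_zero (K := 𝕜))] with z hz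
  rw [← hz, RatFunc.eval_X]

namespace HasLimitAtInfty

variable {f g : RatFunc 𝕜} {c d : 𝕜}

theorem unique (hc : HasLimitAtInfty f c) (hd : HasLimitAtInfty f d) : c = d :=
  tendsto_nhds_unique hc hd

theorem add (hf : HasLimitAtInfty f c) (hg : HasLimitAtInfty g d) :
    HasLimitAtInfty (f + g) (c + d) := by
  refine (Tendsto.add hf hg).congr' ?_
  filter_upwards [eventually_eval₂_ne_zero f.denom_ne_zero,
    eventually_eval₂_ne_zero g.denom_ne_zero] with z hz hz'
  rw [RatFunc.eval_add _ _ hz hz']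

theorem mul (hf : HasLimitAtInfty f c) (hg : HasLimitAtInfty g d) :
    HasLimitAtInfty (f * g) (c * d) := by
  refine (Tendsto.mul hf hg).congr' ?_
  filter_upwards [eventually_eval₂_ne_zero f.denom_ne_zero,
    eventually_eval₂_ne_zero g.denom_ne_zero] with z hz hz'
  rw [RatFunc.eval_mul _ _ hz hz']

theorem ne_zero (hf : HasLimitAtInfty f c) (hc : c ≠ 0) : f ≠ 0 := by
  rintro rfl
  exact hc (hf.unique (by simpa using hasLimitAtInfty_C (0 : 𝕜)))

theorem inv (hf : HasLimitAtInfty f c) (hc : c ≠ 0) : HasLimitAtInfty f⁻¹ c⁻¹ :=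
  (Tendsto.inv₀ hf hc).congr' (eventually_eval_inv (hf.ne_zero hc))

end HasLimitAtInfty

/-- The ring of proper rational functions, that is, of those that converge at infinity. -/
def properSubalgebra (𝕜 : Type*) [NontriviallyNormedField 𝕜] : Subalgebra 𝕜 (RatFunc 𝕜) where
  carrier := {f | ∃ d, HasLimitAtInfty f d}
  mul_mem' := by
    rintro f g ⟨c, hc⟩ ⟨d, hd⟩
    exact ⟨c * d, hc.mul hd⟩
  add_mem' := by
    rintro f g ⟨c, hc⟩ ⟨d, hd⟩
    exact ⟨c + d, hc.add hd⟩
  algebraMap_mem' c := ⟨c, by simpa only [RatFunc.algebraMap_eq_C] using hasLimitAtInfty_C c⟩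

/-- The value at infinity of a proper rational function. -/
noncomputable def valueAtInfty : properSubalgebra 𝕜 →ₐ[𝕜] 𝕜 where
  toFun f := f.2.choose
  map_one' := (1 : properSubalgebra 𝕜).2.choose_spec.unique
    (by simpa using hasLimitAtInfty_C (1 : 𝕜))
  map_mul' f g := (f * g).2.choose_spec.unique (f.2.choose_spec.mul g.2.choose_spec)
  map_zero' := (0 : properSubalgebra 𝕜).2.choose_spec.unique
    (by simpa using hasLimitAtInfty_C (0 : 𝕜))
  map_add' f g := (f + g).2.choose_spec.unique (f.2.choose_spec.add g.2.choose_spec)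
  commutes' c := (algebraMap 𝕜 (properSubalgebra 𝕜) c).2.choose_spec.unique
    (by simpa [RatFunc.algebraMap_eq_C] using hasLimitAtInfty_C c)

theorem hasLimitAtInfty_valueAtInfty (f : properSubalgebra 𝕜) :
    HasLimitAtInfty (f : RatFunc 𝕜) (valueAtInfty f) :=
  f.2.choose_spec

instance : IsLocalHom (valueAtInfty (𝕜 := 𝕜)) where
  map_nonunit f hf := by
    have hlim := hasLimitAtInfty_valueAtInfty f
    exact .of_mul_eq_one ⟨(f : RatFunc 𝕜)⁻¹, _, hlim.inv hf.ne_zero⟩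
      (Subtype.ext (mul_inv_cancel₀ (hlim.ne_zero hf.ne_zero)))

variable (𝕜) in
/-- The proper rational function `λ⁻¹`. -/
noncomputable def properInvX : properSubalgebra 𝕜 :=
  ⟨RatFunc.X⁻¹, 0, hasLimitAtInfty_inv_X⟩

theorem valueAtInfty_properInvX : valueAtInfty (properInvX 𝕜) = 0 :=
  (hasLimitAtInfty_valueAtInfty _).unique hasLimitAtInfty_inv_X

theorem pencil_eq_X_smul_map {ι : Type*} (A E : Matrix ι ι 𝕜) :
    (RatFunc.X : RatFunc 𝕜) • E.map RatFunc.C - A.map RatFunc.C =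
      (RatFunc.X : RatFunc 𝕜) • (E.map (algebraMap 𝕜 (properSubalgebra 𝕜)) -
        properInvX 𝕜 • A.map (algebraMap 𝕜 (properSubalgebra 𝕜))).map (properSubalgebra 𝕜).val := by
  ext i j
  simp [properInvX, mul_sub, RatFunc.X_ne_zero, RatFunc.algebraMap_eq_C]

variable {ι : Type*} [Fintype ι] [DecidableEq ι]

theorem isUnit_sub_properInvX_smul {E : Matrix ι ι (properSubalgebra 𝕜)} (hE : IsUnit E)
    (A : Matrix ι ι (properSubalgebra 𝕜)) : IsUnit (E - properInvX 𝕜 • A) := by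
  have value_eq : valueAtInfty.mapMatrix (E - properInvX 𝕜 • A) = valueAtInfty.mapMatrix E := by
    ext i j
    simp [valueAtInfty_properInvX]
  rw [Matrix.isUnit_iff_isUnit_det]
  refine IsUnit.of_map valueAtInfty _ ?_
  rw [AlgHom.map_det, value_eq, ← Matrix.isUnit_iff_isUnit_det]
  exact hE.map valueAtInfty.mapMatrix

theorem isUnit_map_algebraMap_sub_properInvX_smul (A : Matrix ι ι 𝕜) {E : Matrix ι ι 𝕜}
    (hE : IsUnit E) :
    IsUnit (E.map (algebraMap 𝕜 (properSubalgebra 𝕜)) -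
      properInvX 𝕜 • A.map (algebraMap 𝕜 (properSubalgebra 𝕜))) :=
  isUnit_sub_properInvX_smul (hE.map (algebraMap 𝕜 (properSubalgebra 𝕜)).mapMatrix) _

theorem isUnit_pencil (A : Matrix ι ι 𝕜) {E : Matrix ι ι 𝕜} (hE : IsUnit E) :
    IsUnit ((RatFunc.X : RatFunc 𝕜) • E.map RatFunc.C - A.map RatFunc.C) := by
  rw [pencil_eq_X_smul_map]
  exact ((isUnit_map_algebraMap_sub_properInvX_smul A hE).map
    (properSubalgebra 𝕜).val.mapMatrix).smul (Units.mk0 (RatFunc.X : RatFunc 𝕜) RatFunc.X_ne_zero)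

theorem exists_proper_inv_pencil (A : Matrix ι ι 𝕜) {E : Matrix ι ι 𝕜} (hE : IsUnit E) :
    ∃ F : Matrix ι ι (properSubalgebra 𝕜), F.map (properSubalgebra 𝕜).val =
      ((RatFunc.X : RatFunc 𝕜) • E.map RatFunc.C - A.map RatFunc.C)⁻¹ := by
  obtain ⟨u, hu⟩ := isUnit_map_algebraMap_sub_properInvX_smul A hE
  refine ⟨properInvX 𝕜 • ↑u⁻¹, (Matrix.inv_eq_right_inv ?_).symm⟩
  have smul_eq : (properInvX 𝕜 • (↑u⁻¹ : Matrix ι ι (properSubalgebra 𝕜))).map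
      (properSubalgebra 𝕜).val = (RatFunc.X : RatFunc 𝕜)⁻¹ •
        (↑u⁻¹ : Matrix ι ι (properSubalgebra 𝕜)).map (properSubalgebra 𝕜).val := by
    ext i j
    simp [properInvX]
  rw [pencil_eq_X_smul_map, ← hu, smul_eq, smul_mul_smul_comm, mul_inv_cancel₀ RatFunc.X_ne_zero,
    one_smul, ← Matrix.map_mul, ← Units.val_mul, mul_inv_cancel, Units.val_one,
    Matrix.map_one _ (map_zero _) (map_one _)]

end ProperRational

section Division

variable {K ι κ : Type*} [CommRing K] [Fintype ι] [DecidableEq ι] [Finite κ]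

theorem exists_eq_mul_pencil_add_const (A : Matrix ι ι K) {E : Matrix ι ι K} (hE : IsUnit E)
    (M : Matrix κ ι K[X]) :
    ∃ (Q : Matrix κ ι K[X]) (N : Matrix κ ι K),
      M = Q * ((X : K[X]) • E.map C - A.map C) + N.map C := by
  obtain ⟨d, hd⟩ : ∃ d, ∀ i j, (M i j).natDegree ≤ d := by
    obtain ⟨d, hd⟩ := Finite.bddAbove_range fun ij : κ × ι => (M ij.1 ij.2).natDegree
    exact ⟨d, fun i j => hd ⟨(i, j), rfl⟩⟩
  obtain ⟨E, rfl⟩ := hE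
  induction d generalizing M with
  | zero =>
    refine ⟨0, M.map fun p => p.coeff 0, ?_⟩
    ext1 i j
    simpa using eq_C_of_natDegree_le_zero (hd i j)
  | succ d ih =>
    obtain ⟨Q, N, hQ⟩ := ih (M.map divX) fun i j => by
      rw [Matrix.map_apply, natDegree_divX_eq_natDegree_tsub_one]
      exact Nat.sub_le_of_le_add (hd i j)
    have eq_X_smul_add : M = (X : K[X]) • M.map divX + (M.map fun p => p.coeff 0).map C := by
      ext1 i j
      simp
    have map_mul_map : (N * (E⁻¹).val).map C * E.val.map C = N.map (C : K →+* K[X]) := by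
      rw [← Matrix.map_mul, Matrix.mul_assoc, Units.inv_mul, Matrix.mul_one]
    refine ⟨(X : K[X]) • Q + (N * (E⁻¹).val).map C,
      N * (E⁻¹).val * A + M.map fun p => p.coeff 0, ?_⟩
    conv_lhs => rw [eq_X_smul_add, hQ]
    rw [Matrix.add_mul, Matrix.mul_sub ((N * (E⁻¹).val).map C), Matrix.mul_smul (Matrix.map _ C),
      map_mul_map, ← Matrix.map_mul, Matrix.map_add _ (map_add _), Matrix.smul_mul, smul_add]
    abel

theorem exists_eq_pencil_mul_add_const (A : Matrix ι ι K) {E : Matrix ι ι K} (hE : IsUnit E)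
    (M : Matrix ι κ K[X]) :
    ∃ (Q : Matrix ι κ K[X]) (N : Matrix ι κ K),
      M = ((X : K[X]) • E.map C - A.map C) * Q + N.map C := by
  obtain ⟨Q, N, h⟩ := exists_eq_mul_pencil_add_const A.transpose
    ((Matrix.isUnit_transpose E).2 hE) M.transpose
  refine ⟨Q.transpose, N.transpose, ?_⟩
  have h_transpose := congrArg Matrix.transpose h
  rwa [Matrix.transpose_transpose, Matrix.transpose_add, Matrix.transpose_mul] at h_transpose

end Division

section Transfer

theorem add_mul_nonsing_inv_mul_add {ι κ κ' K : Type*} [Fintype ι] [DecidableEq ι] [CommRing K]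
    {L : Matrix ι ι K} (hL : IsUnit L.det) (Q₁ C₁ : Matrix κ ι K) (Q₂ B₂ : Matrix ι κ' K) :
    (Q₁ * L + C₁) * L⁻¹ * (L * Q₂ + B₂) =
      Q₁ * L * Q₂ + Q₁ * B₂ + C₁ * Q₂ + C₁ * L⁻¹ * B₂ := by
  rw [Matrix.add_mul, Matrix.mul_nonsing_inv_cancel_right _ _ hL, Matrix.mul_add, Matrix.add_mul,
    Matrix.add_mul, ← Matrix.mul_assoc, ← Matrix.mul_assoc,
    Matrix.nonsing_inv_mul_cancel_right _ _ hL]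
  abel

theorem map_algebraMap_pencil {ι K : Type*} [Field K] (A E : Matrix ι ι K) :
    ((X : K[X]) • E.map C - A.map C).map (algebraMap K[X] (RatFunc K)) =
      (RatFunc.X : RatFunc K) • E.map RatFunc.C - A.map RatFunc.C := by
  ext i j
  simpa using mul_comm _ _

theorem map_algebraMap_map_C {ι κ K : Type*} [Field K] (M : Matrix ι κ K) :
    (M.map (C : K →+* K[X])).map (algebraMap K[X] (RatFunc K)) = M.map RatFunc.C := by
  ext i j
  simp

namespace Realization

variable {ι κ : Type} {r : ℕ}

theorem isUnit_E (R : Realization ι r) : IsUnit R.E :=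
  (Matrix.isUnit_iff_isUnit_det _).2 R.det_E_ne_zero.isUnit

/-- The pencil `λ E - A` over the field of rational functions. -/
noncomputable def ratPencil (R : Realization ι r) : Matrix (Fin r) (Fin r) (RatFunc ℂ) :=
  (RatFunc.X : RatFunc ℂ) • R.E.map RatFunc.C - R.A.map RatFunc.C

theorem isUnit_det_ratPencil (R : Realization ι r) : IsUnit R.ratPencil.det :=
  (Matrix.isUnit_iff_isUnit_det _).1 (isUnit_pencil R.A R.isUnit_E)

theorem transfer_eq_add (R : Realization ι r) :
    R.transfer = R.P.map (algebraMap ℂ[X] (RatFunc ℂ)) +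
      R.C.map RatFunc.C * R.ratPencil⁻¹ * R.B.map RatFunc.C :=
  rfl

theorem exists_transfer_eq_mul [Fintype ι] [Finite κ] (R : Realization ι r) (M : Matrix κ ι ℂ[X])
    (N : Matrix ι κ ℂ[X]) :
    ∃ R' : Realization κ r, R'.transfer =
      M.map (algebraMap ℂ[X] (RatFunc ℂ)) * R.transfer * N.map (algebraMap ℂ[X] (RatFunc ℂ)) := by
  set φ := algebraMap ℂ[X] (RatFunc ℂ) with hφ
  obtain ⟨Q₁, C₁, hC⟩ :=
    exists_eq_mul_pencil_add_const R.A R.isUnit_E (M * R.C.map Polynomial.C)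
  obtain ⟨Q₂, B₂, hB⟩ :=
    exists_eq_pencil_mul_add_const R.A R.isUnit_E (R.B.map Polynomial.C * N)
  have map_pencil := map_algebraMap_pencil R.A R.E
  set L := (X : ℂ[X]) • R.E.map Polynomial.C - R.A.map Polynomial.C
  have map_mul_C : M.map φ * R.C.map RatFunc.C = Q₁.map φ * R.ratPencil + C₁.map RatFunc.C := by
    rw [ratPencil, ← map_pencil, ← map_algebraMap_map_C, ← map_algebraMap_map_C, ← Matrix.map_mul,
      hC, Matrix.map_add _ (map_add φ), Matrix.map_mul]
  have map_B_mul : R.B.map RatFunc.C * N.map φ = R.ratPencil * Q₂.map φ + B₂.map RatFunc.C := by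
    rw [ratPencil, ← map_pencil, ← map_algebraMap_map_C, ← map_algebraMap_map_C, ← Matrix.map_mul,
      hB, Matrix.map_add _ (map_add φ), Matrix.map_mul]
  refine ⟨⟨M * R.P * N + (Q₁ * L * Q₂ + Q₁ * B₂.map Polynomial.C + C₁.map Polynomial.C * Q₂),
    R.A, R.E, B₂, C₁, R.det_E_ne_zero⟩, ?_⟩
  calc _ = M.map φ * R.P.map φ * N.map φ + ((Q₁.map φ * R.ratPencil * Q₂.map φ +
          Q₁.map φ * B₂.map RatFunc.C + C₁.map RatFunc.C * Q₂.map φ) +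
            C₁.map RatFunc.C * R.ratPencil⁻¹ * B₂.map RatFunc.C) := by
        simp only [transfer, Matrix.map_add _ (map_add _), Matrix.map_mul, map_pencil,
          map_algebraMap_map_C, ratPencil, add_assoc, hφ]
    _ = M.map φ * R.P.map φ * N.map φ +
          M.map φ * R.C.map RatFunc.C * R.ratPencil⁻¹ * (R.B.map RatFunc.C * N.map φ) := by
        rw [map_mul_C, map_B_mul, add_mul_nonsing_inv_mul_add R.isUnit_det_ratPencil]
    _ = M.map φ * R.transfer * N.map φ := by
        simp only [transfer_eq_add, Matrix.mul_add, Matrix.add_mul, Matrix.mul_assoc, hφ]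

end Realization

end Transfer

section DiagOne

/-- The homomorphism `M ↦ diag(M, 1)`, with an identity block indexed by `κ`. -/
def diagOneHom {ι : Type*} (κ : Type*) {K : Type*} [Fintype ι] [DecidableEq ι] [Fintype κ]
    [DecidableEq κ] [Semiring K] : Matrix ι ι K →* Matrix (ι ⊕ κ) (ι ⊕ κ) K where
  toFun M := Matrix.fromBlocks M 0 0 1
  map_one' := Matrix.fromBlocks_one
  map_mul' M N := by simp [Matrix.fromBlocks_multiply]

variable {ι κ K : Type*} [Fintype ι] [DecidableEq ι] [Fintype κ] [DecidableEq κ]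

theorem diagOneHom_apply [Semiring K] (M : Matrix ι ι K) :
    diagOneHom κ M = Matrix.fromBlocks M 0 0 1 :=
  rfl

theorem diagOneHom_map_C [CommSemiring K] (M : Matrix ι ι K) :
    (diagOneHom κ M).map C = diagOneHom κ (M.map (C : K →+* K[X])) := by
  simp [diagOneHom_apply, Matrix.fromBlocks_map, Matrix.map_one]

theorem diagOneHom_mul_fromBlocks_mul [Semiring K] (U V W : Matrix ι ι K) (Y : Matrix ι κ K)
    (Z : Matrix κ ι K) (D : Matrix κ κ K) :
    diagOneHom κ U * Matrix.fromBlocks W Y Z D * diagOneHom κ V =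
      Matrix.fromBlocks (U * W * V) (U * Y) (Z * V) D := by
  simp [diagOneHom_apply, Matrix.fromBlocks_multiply]

theorem fromBlocks_mul_left_eq [Semiring K] (U W : Matrix ι ι K) (D : Matrix κ κ K) :
    Matrix.fromBlocks (U * W) 0 0 D = Matrix.fromBlocks U 0 0 D * diagOneHom κ W := by
  simp [diagOneHom_apply, Matrix.fromBlocks_multiply]

theorem fromBlocks_mul_right_eq [Semiring K] (U W : Matrix ι ι K) (D : Matrix κ κ K) :
    Matrix.fromBlocks (W * U) 0 0 D = diagOneHom κ W * Matrix.fromBlocks U 0 0 D := by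
  simp [diagOneHom_apply, Matrix.fromBlocks_multiply]

end DiagOne

section SystemMatrix

namespace Realization

theorem IsMinimal.of_mul_transfer_mul_eq {ι κ : Type} {r : ℕ} [Fintype ι] [Finite κ]
    {R : Realization κ r} (hR : R.IsMinimal) {T : Realization ι r} (M : Matrix κ ι ℂ[X])
    (N : Matrix ι κ ℂ[X])
    (h : M.map (algebraMap ℂ[X] (RatFunc ℂ)) * T.transfer * N.map (algebraMap ℂ[X] (RatFunc ℂ)) =
      R.transfer) :
    T.IsMinimal := by
  intro r' T' hT'
  obtain ⟨R', hR'⟩ := T'.exists_transfer_eq_mul M N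
  exact hR r' R' (by rw [hR', hT', h])

variable {ι : Type} {r : ℕ} [Fintype ι] [DecidableEq ι]

theorem mul_transfer_mul_of_mul_systemMatrix_mul {T T' : Realization ι r} {U V : Matrix ι ι ℂ[X]}
    (h : diagOneHom (Fin r) U * T.systemMatrix * diagOneHom (Fin r) V = T'.systemMatrix) :
    U.map (algebraMap ℂ[X] (RatFunc ℂ)) * T.transfer * V.map (algebraMap ℂ[X] (RatFunc ℂ)) =
      T'.transfer := by
  rw [systemMatrix, systemMatrix, diagOneHom_mul_fromBlocks_mul, Matrix.fromBlocks_inj] at h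
  obtain ⟨hP, hC, hB, hL⟩ := h
  replace hC := congrArg (Matrix.map · (algebraMap ℂ[X] (RatFunc ℂ))) hC
  replace hB := congrArg (Matrix.map · (algebraMap ℂ[X] (RatFunc ℂ))) hB
  have ratPencil_eq : T.ratPencil = T'.ratPencil := by
    rw [ratPencil, ratPencil, ← map_algebraMap_pencil, ← map_algebraMap_pencil, ← neg_sub, hL,
      neg_sub]
  simp only [Matrix.map_mul, map_algebraMap_map_C] at hC hB
  rw [transfer_eq_add, transfer_eq_add, ← hP, ← hC, ← hB, ← ratPencil_eq]
  simp only [Matrix.map_mul, Matrix.mul_add, Matrix.add_mul, Matrix.mul_assoc]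

/-- The realization of `M G(λ) N` for constant matrices `M`, `N`. -/
noncomputable def mulMul (R : Realization ι r) (M N : Matrix ι ι ℂ) : Realization ι r where
  P := M.map Polynomial.C * R.P * N.map Polynomial.C
  A := R.A
  E := R.E
  B := R.B * N
  C := M * R.C
  det_E_ne_zero := R.det_E_ne_zero

theorem systemMatrix_mulMul (R : Realization ι r) (M N : Matrix ι ι ℂ) :
    (R.mulMul M N).systemMatrix =
      diagOneHom (Fin r) (M.map Polynomial.C) * R.systemMatrix *
        diagOneHom (Fin r) (N.map Polynomial.C) := by
  simp only [systemMatrix, mulMul, diagOneHom_mul_fromBlocks_mul, Matrix.map_mul]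

end Realization

end SystemMatrix

section LastBlock

theorem val_add_one_eq_iff_eq_last {m : ℕ} {q : Fin (m + 1)} :
    (q : ℕ) + 1 = m + 1 ↔ q = Fin.last m := by
  simp [Fin.ext_iff]

variable {m n r : ℕ} {K K' : Type}

theorem map_diagLast [Zero K] [One K] [Zero K'] [One K'] {F : Type*} [FunLike F K K']
    [ZeroHomClass F K K'] [OneHomClass F K K'] (f : F) (W : Matrix (Fin n) (Fin n) K) :
    (diagLast m W).map f = diagLast m (W.map f) := by
  ext ⟨p, i⟩ ⟨q, j⟩
  simp only [diagLast, Matrix.map_apply, Matrix.comp_apply, Matrix.diagonal_apply]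
  split_ifs <;> simp [Matrix.one_apply, apply_ite f]

theorem map_lastCol [Zero K] [Zero K'] {F : Type*} [FunLike F K K'] [ZeroHomClass F K K'] (f : F)
    (M : Matrix (Fin n) (Fin r) K) : (lastCol m M).map f = lastCol m (M.map f) := by
  ext p q
  simp only [lastCol, Matrix.map_apply, Matrix.of_apply, apply_ite f, map_zero]

theorem map_lastRow [Zero K] [Zero K'] {F : Type*} [FunLike F K K'] [ZeroHomClass F K K'] (f : F)
    (M : Matrix (Fin r) (Fin n) K) : (lastRow m M).map f = lastRow m (M.map f) := by
  ext p q
  simp only [lastRow, Matrix.map_apply, Matrix.of_apply, apply_ite f, map_zero]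

theorem lastCol_mul [NonUnitalNonAssocSemiring K] (M : Matrix (Fin n) (Fin r) K)
    {s : ℕ} (N : Matrix (Fin r) (Fin s) K) : lastCol m M * N = lastCol m (M * N) := by
  ext p k
  simp only [lastCol, Matrix.mul_apply, Matrix.of_apply]
  split_ifs <;> simp

theorem diagLast_add_lastCol_mul_lastRow [NonAssocSemiring K] (W : Matrix (Fin n) (Fin n) K)
    (M : Matrix (Fin n) (Fin r) K) (N : Matrix (Fin r) (Fin n) K) :
    diagLast m W + lastCol m M * lastRow m N = diagLast m (W + M * N) := by
  ext ⟨p, i⟩ ⟨q, j⟩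
  simp only [diagLast, lastCol, lastRow, Matrix.add_apply, Matrix.mul_apply, Matrix.comp_apply,
    Matrix.of_apply, Matrix.diagonal_apply]
  rcases eq_or_ne p q with rfl | hpq
  · by_cases hp : (p : ℕ) + 1 = m <;> simp [hp, Matrix.mul_apply]
  · have h : ¬((p : ℕ) + 1 = m ∧ (q : ℕ) + 1 = m) := by omega
    by_cases hp : (p : ℕ) + 1 = m <;> simp_all

variable [Semiring K]

theorem comp_mul {ι κ : Type*} [Fintype ι] [Fintype κ] (M N : Matrix ι ι (Matrix κ κ K)) :
    Matrix.comp ι ι κ κ K (M * N) = Matrix.comp ι ι κ κ K M * Matrix.comp ι ι κ κ K N :=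
  map_mul (Matrix.compRingEquiv ι κ K) M N

theorem comp_mul_lastCol {U : Matrix (Fin (m + 1)) (Fin (m + 1)) (Matrix (Fin n) (Fin n) K)}
    (hU : Matrix.mulVec U (Pi.single (Fin.last m) 1) = Pi.single (Fin.last m) 1)
    (M : Matrix (Fin n) (Fin r) K) :
    Matrix.comp _ _ _ _ _ U * lastCol (m + 1) M = lastCol (m + 1) M := by
  have apply_last (p) : U p (Fin.last m) = if p = Fin.last m then 1 else 0 := by
    simpa [Pi.single_apply] using congrFun hU p
  ext ⟨p, i⟩ k
  simp only [Matrix.mul_apply, lastCol, Matrix.of_apply, Fintype.sum_prod_type, Matrix.comp_apply,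
    val_add_one_eq_iff_eq_last, mul_ite, mul_zero]
  rw [Finset.sum_eq_single (Fin.last m) (fun q _ hq => by simp [hq]) (by simp)]
  by_cases hp : p = Fin.last m <;> simp [apply_last, hp, Matrix.one_apply]

theorem lastRow_mul_comp {V : Matrix (Fin (m + 1)) (Fin (m + 1)) (Matrix (Fin n) (Fin n) K)}
    (hV : Matrix.vecMul (Pi.single (Fin.last m) 1) V = Pi.single (Fin.last m) 1)
    (M : Matrix (Fin r) (Fin n) K) :
    lastRow (m + 1) M * Matrix.comp _ _ _ _ _ V = lastRow (m + 1) M := by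
  have last_apply (p) : V (Fin.last m) p = if p = Fin.last m then 1 else 0 := by
    simpa [Pi.single_apply] using congrFun hV p
  ext k ⟨p, i⟩
  simp only [Matrix.mul_apply, lastRow, Matrix.of_apply, Fintype.sum_prod_type, Matrix.comp_apply,
    val_add_one_eq_iff_eq_last, ite_mul, zero_mul]
  rw [Finset.sum_eq_single (Fin.last m) (fun q _ hq => by simp [hq]) (by simp)]
  by_cases hp : p = Fin.last m <;> simp [last_apply, hp, Matrix.one_apply]

end LastBlock

section MapFiedlerProd

variable {S S' : Type*} [Semiring S] [Semiring S']

theorem map_blockDiagFirst (f : S →+* S') (m : ℕ) (W : S) :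
    (blockDiagFirst m W).map f = blockDiagFirst m (f W) := by
  simp [blockDiagFirst, Matrix.diagonal_map, apply_ite f]

theorem map_swapBlock (f : S →+* S') (m i : ℕ) (W : S) :
    (swapBlock m i W).map f = swapBlock m i (f W) := by
  ext p q
  simp only [swapBlock, Matrix.map_apply, Matrix.of_apply, apply_ite f, map_one, map_zero]

theorem map_swapProd (f : S →+* S') (m : ℕ) (A : ℕ → S) (l : List ℕ) :
    (swapProd m A l).map f = swapProd m (f ∘ A) l := by
  induction l with
  | nil => simp [swapProd]
  | cons i l ih => rw [swapProd_cons, Matrix.map_mul, ih, map_swapBlock, swapProd_cons]; rfl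

theorem map_comp_fiedlerProd {ι : Type*} [Fintype ι] [DecidableEq ι] (f : S →+* S') (m : ℕ)
    (A : ℕ → Matrix ι ι S) (l : List ℕ) (W : Matrix ι ι S) (l' : List ℕ) :
    (Matrix.comp _ _ _ _ _ (fiedlerProd m A l W l')).map f =
      Matrix.comp _ _ _ _ _ (fiedlerProd m (fun j => (A j).map f) l (W.map f) l') := by
  rw [← Matrix.comp_map_map]
  change Matrix.comp _ _ _ _ _ ((fiedlerProd m A l W l').map (f.mapMatrix (m := ι))) = _
  rw [fiedlerProd, Matrix.map_mul, Matrix.map_mul, map_swapProd, map_swapProd, map_blockDiagFirst]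
  rfl

end MapFiedlerProd

section Linearization

namespace Realization

variable {m n r : ℕ}

/-- The realization of `diag(1, …, 1, G(λ))` with `m` diagonal blocks. -/
noncomputable def extend (R : Realization (Fin n) r) (m : ℕ) : Realization (Fin m × Fin n) r where
  P := diagLast m R.P
  A := R.A
  E := R.E
  B := lastRow m R.B
  C := lastCol m R.C
  det_E_ne_zero := R.det_E_ne_zero

theorem systemMatrix_extend (R : Realization (Fin n) r) (m : ℕ) :
    (R.extend m).systemMatrix = R.extendedSystemMatrix m := by
  rw [systemMatrix, extendedSystemMatrix, extend, map_lastCol, map_lastRow]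

theorem transfer_extend (R : Realization (Fin n) r) (m : ℕ) :
    (R.extend m).transfer = diagLast m R.transfer := by
  rw [transfer, extend, map_diagLast, map_lastCol, map_lastRow, lastCol_mul,
    diagLast_add_lastCol_mul_lastRow, transfer]

theorem IsMinimal.of_mul_systemMatrix_mul {R : Realization (Fin n) r} (hR : R.IsMinimal)
    {T : Realization (Fin (m + 1) × Fin n) r}
    {U V : Matrix (Fin (m + 1) × Fin n) (Fin (m + 1) × Fin n) ℂ[X]}
    (h : diagOneHom (Fin r) U * T.systemMatrix * diagOneHom (Fin r) V =
      R.extendedSystemMatrix (m + 1)) :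
    T.IsMinimal := by
  rw [← systemMatrix_extend] at h
  replace h := mul_transfer_mul_of_mul_systemMatrix_mul h
  rw [transfer_extend] at h
  refine hR.of_mul_transfer_mul_eq (U.submatrix (fun i => (Fin.last m, i)) id)
    (V.submatrix id fun i => (Fin.last m, i)) ?_
  calc _ = (diagLast (m + 1) R.transfer).submatrix (fun i => (Fin.last m, i))
        fun i => (Fin.last m, i) := by rw [← h]; rfl
    _ = R.transfer := by ext i j; simp [diagLast]

end Realization

theorem isUnimodular_iff_isUnit {ι : Type} [Fintype ι] [DecidableEq ι] {U : Matrix ι ι ℂ[X]} :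
    IsUnimodular U ↔ IsUnit U := by
  simp only [IsUnimodular, Matrix.isUnit_iff_isUnit_det, Polynomial.isUnit_iff, isUnit_iff_ne_zero,
    eq_comm]

theorem isBiproper_iff_exists_isUnit {ι : Type} [Fintype ι] [DecidableEq ι]
    {F : Matrix ι ι (RatFunc ℂ)} :
    IsBiproper F ↔ ∃ M : Matrix ι ι (properSubalgebra ℂ),
      IsUnit M ∧ M.map (properSubalgebra ℂ).val = F := by
  constructor
  · rintro ⟨D, hD, hF⟩
    set M : Matrix ι ι (properSubalgebra ℂ) := Matrix.of fun i j => ⟨F i j, D i j, hF i j⟩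
    have value_eq : valueAtInfty.mapMatrix M = D := by
      ext i j
      exact (hasLimitAtInfty_valueAtInfty (M i j)).unique (hF i j)
    refine ⟨M, (Matrix.isUnit_iff_isUnit_det M).2 (IsUnit.of_map valueAtInfty _ ?_), rfl⟩
    rw [AlgHom.map_det, value_eq]
    exact hD.isUnit
  · rintro ⟨M, hM, rfl⟩
    refine ⟨valueAtInfty.mapMatrix M, ?_, fun i j => hasLimitAtInfty_valueAtInfty (M i j)⟩
    rw [← AlgHom.map_det]
    exact (((Matrix.isUnit_iff_isUnit_det M).1 hM).map valueAtInfty).ne_zero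

namespace IsBiproper

variable {ι : Type} [Fintype ι] [DecidableEq ι]

theorem mul {F G : Matrix ι ι (RatFunc ℂ)} (hF : IsBiproper F) (hG : IsBiproper G) :
    IsBiproper (F * G) := by
  obtain ⟨M, hM, rfl⟩ := isBiproper_iff_exists_isUnit.1 hF
  obtain ⟨N, hN, rfl⟩ := isBiproper_iff_exists_isUnit.1 hG
  exact isBiproper_iff_exists_isUnit.2 ⟨M * N, hM.mul hN, Matrix.map_mul⟩

theorem map_C {M : Matrix ι ι ℂ} (hM : IsUnit M) : IsBiproper (M.map RatFunc.C) := by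
  refine ⟨M, ((Matrix.isUnit_iff_isUnit_det M).1 hM).ne_zero, fun i j => ?_⟩
  exact hasLimitAtInfty_C (M i j)

end IsBiproper

theorem map_inv_mul_map {ι K K' : Type*} [Fintype ι] [DecidableEq ι] [Semiring K] [Semiring K']
    (f : K →+* K') (M : (Matrix ι ι K)ˣ) : M⁻¹.val.map f * M.val.map f = 1 := by
  rw [← Matrix.map_mul, Units.inv_mul, Matrix.map_one _ (map_zero _) (map_one _)]

theorem map_mul_map_inv {ι K K' : Type*} [Fintype ι] [DecidableEq ι] [Semiring K] [Semiring K']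
    (f : K →+* K') (M : (Matrix ι ι K)ˣ) : M.val.map f * M⁻¹.val.map f = 1 := by
  simpa using map_inv_mul_map f M⁻¹

theorem isUnit_map_C {ι K : Type*} [Fintype ι] [DecidableEq ι] [CommSemiring K] {M : Matrix ι ι K}
    (hM : IsUnit M) : IsUnit (M.map (C : K →+* K[X])) :=
  hM.map (C : K →+* K[X]).mapMatrix

namespace Realization

variable {ι : Type} {r : ℕ} [Fintype ι]

theorem transfer_mulMul (R : Realization ι r) (M N : Matrix ι ι ℂ) :
    (R.mulMul M N).transfer = M.map RatFunc.C * R.transfer * N.map RatFunc.C := by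
  classical
  rw [← mul_transfer_mul_of_mul_systemMatrix_mul (R.systemMatrix_mulMul M N).symm,
    map_algebraMap_map_C, map_algebraMap_map_C]

variable [DecidableEq ι]

theorem IsMinimal.mulMul {R : Realization ι r} (hR : R.IsMinimal) (M N : (Matrix ι ι ℂ)ˣ) :
    (R.mulMul M N).IsMinimal := by
  refine hR.of_mul_transfer_mul_eq (M⁻¹.val.map Polynomial.C) (N⁻¹.val.map Polynomial.C) ?_
  rw [transfer_mulMul, map_algebraMap_map_C, map_algebraMap_map_C, ← Matrix.mul_assoc,
    ← Matrix.mul_assoc, map_inv_mul_map, Matrix.one_mul, Matrix.mul_assoc, map_mul_map_inv,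
    Matrix.mul_one]

end Realization

theorem IsRosenbrockStrongLinearization.diagOneHom_mul_mul {m n r : ℕ} {R : Realization (Fin n) r}
    {L : Matrix ((Fin m × Fin n) ⊕ Fin r) ((Fin m × Fin n) ⊕ Fin r) ℂ[X]}
    (h : IsRosenbrockStrongLinearization m R L)
    (M N : (Matrix (Fin m × Fin n) (Fin m × Fin n) ℂ)ˣ) :
    IsRosenbrockStrongLinearization m R
      (diagOneHom (Fin r) (M.val.map C) * L * diagOneHom (Fin r) (N.val.map C)) := by
  obtain ⟨T, ⟨𝒳, 𝒴, hP⟩, rfl, hT, ⟨U, V, U₀, V₀, hU, hV, hU₀, hV₀, ha⟩, Ol, Or, hOl, hOr, hb⟩ := h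
  rw [isUnimodular_iff_isUnit] at hU hV
  refine ⟨T.mulMul M N, ⟨M * 𝒳 * N, M * 𝒴 * N, ?_⟩, T.systemMatrix_mulMul M N, hT.mulMul M N,
    ⟨U * M⁻¹.val.map C, N⁻¹.val.map C * V, U₀, V₀,
      isUnimodular_iff_isUnit.2 (hU.mul (isUnit_map_C M⁻¹.isUnit)),
      isUnimodular_iff_isUnit.2 ((isUnit_map_C N⁻¹.isUnit).mul hV), hU₀, hV₀, ?_⟩,
    Ol * M⁻¹.val.map RatFunc.C, N⁻¹.val.map RatFunc.C * Or, hOl.mul (.map_C M⁻¹.isUnit),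
    .mul (.map_C N⁻¹.isUnit) hOr, ?_⟩
  · simp only [Realization.mulMul, hP, Matrix.mul_sub, Matrix.sub_mul, Matrix.map_mul,
      Matrix.mul_smul, Matrix.smul_mul]
  · calc _ = Matrix.fromBlocks U 0 0 (U₀.map C) *
            diagOneHom (Fin r) (M⁻¹.val.map C * M.val.map C) * T.systemMatrix *
          (diagOneHom (Fin r) (N.val.map C * N⁻¹.val.map C) *
            Matrix.fromBlocks V 0 0 (V₀.map C)) := by
          rw [map_mul, map_mul, fromBlocks_mul_left_eq, fromBlocks_mul_right_eq]
          simp only [Matrix.mul_assoc]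
      _ = R.extendedSystemMatrix m := by
          rw [map_inv_mul_map, map_mul_map_inv, map_one, Matrix.mul_one, Matrix.one_mul, ha]
  · calc _ = Ol * (M⁻¹.val.map RatFunc.C * M.val.map RatFunc.C) *
            ((RatFunc.X : RatFunc ℂ)⁻¹ • T.transfer) *
            (N.val.map RatFunc.C * N⁻¹.val.map RatFunc.C) * Or := by
          rw [Realization.transfer_mulMul]
          simp only [Matrix.mul_assoc, Matrix.mul_smul, Matrix.smul_mul]
      _ = diagLast m (((RatFunc.X : RatFunc ℂ) ^ m)⁻¹ • R.transfer) := by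
          rw [map_inv_mul_map, map_mul_map_inv, Matrix.mul_one, Matrix.mul_one, hb]

end Linearization

section FiedlerRealization

theorem inv_pow_smul_sum_add_add {K M : Type*} [Field K] [AddCommGroup M] [Module K M] {x : K}
    (hx : x ≠ 0) (A : ℕ → M) (Z : M) (m : ℕ) :
    (x ^ (m + 1))⁻¹ •
        (∑ j ∈ Finset.range m, x ^ (j + 1) • A (j + 1) + x ^ (m + 1) • A (m + 1) + Z) =
      A (m + 1) + ∑ j ∈ Finset.range m, x⁻¹ ^ (j + 1) • A (m - j) + x⁻¹ ^ (m + 1) • Z := by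
  have sum_eq : (x ^ (m + 1))⁻¹ • ∑ j ∈ Finset.range m, x ^ (j + 1) • A (j + 1) =
      ∑ j ∈ Finset.range m, x⁻¹ ^ (j + 1) • A (m - j) := by
    rw [← Finset.sum_range_reflect, Finset.smul_sum]
    refine Finset.sum_congr rfl fun j hj => ?_
    obtain ⟨k, rfl⟩ := Nat.exists_eq_add_of_lt (Finset.mem_range.1 hj)
    rw [show j + k + 1 - 1 - j = k by omega, show j + k + 1 - j = k + 1 by omega, smul_smul,
      inv_pow]
    congr 1
    rw [inv_mul_eq_iff_eq_mul₀ (pow_ne_zero _ hx), eq_mul_inv_iff_mul_eq₀ (pow_ne_zero _ hx)]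
    ring
  rw [smul_add, smul_add, sum_eq, inv_smul_smul₀ (pow_ne_zero _ hx), inv_pow]
  abel

theorem smul_map_comp_fiedlerProd_sub_diagLast {S S' : Type} [CommRing S] [CommRing S'] {n : ℕ}
    (f : S →+* S') (α : S') (m : ℕ) (A : ℕ → Matrix (Fin n) (Fin n) S) (l : List ℕ)
    (W : Matrix (Fin n) (Fin n) S) (l' : List ℕ) (Z : Matrix (Fin n) (Fin n) S') :
    α • (Matrix.comp _ _ _ _ _ (fiedlerProd m A l W l')).map f - diagLast m Z =
      Matrix.comp _ _ _ _ _ (α • fiedlerProd m (fun j => (A j).map f) l (W.map f) l' -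
        blockDiagLast m Z) := by
  rw [map_comp_fiedlerProd]
  rfl

theorem exists_isBiproper_of_isEquivalent {ι : Type} [Fintype ι] [DecidableEq ι]
    {M N : Matrix ι ι (properSubalgebra ℂ)} (h : IsEquivalent M N) :
    ∃ Ol Or : Matrix ι ι (RatFunc ℂ), IsBiproper Ol ∧ IsBiproper Or ∧
      Ol * M.map (properSubalgebra ℂ).val * Or = N.map (properSubalgebra ℂ).val := by
  obtain ⟨u, v, rfl⟩ := h
  exact ⟨_, _, isBiproper_iff_exists_isUnit.2 ⟨u, u.isUnit, rfl⟩,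
    isBiproper_iff_exists_isUnit.2 ⟨v, v.isUnit, rfl⟩, by rw [Matrix.map_mul, Matrix.map_mul]⟩

namespace Realization

variable {m n r : ℕ} {R : Realization (Fin n) r}

theorem P_eq_sum_add_add (hdeg : ∀ j, m + 1 < j → R.coeff j = 0) :
    R.P = ∑ j ∈ Finset.range m, (X : ℂ[X]) ^ (j + 1) • (R.coeff (j + 1)).map Polynomial.C +
      (X : ℂ[X]) ^ (m + 1) • (R.coeff (m + 1)).map Polynomial.C +
        (R.coeff 0).map Polynomial.C := by
  ext1 i j
  have natDegree_lt : (R.P i j).natDegree < m + 2 :=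
    Nat.lt_succ_of_le (natDegree_le_iff_coeff_eq_zero.2 fun k hk =>
      congrFun (congrFun (hdeg k hk) i) j)
  conv_lhs => rw [(R.P i j).as_sum_range_C_mul_X_pow' natDegree_lt, Finset.sum_range_succ,
    Finset.sum_range_succ']
  simp only [coeff, Matrix.add_apply, Matrix.sum_apply, Matrix.smul_apply, Matrix.map_apply,
    smul_eq_mul, pow_zero, mul_comm _ (Polynomial.C _)]
  ring

/-- The strictly proper part `C (λ E - A)⁻¹ B` of the transfer function. -/
noncomputable def strictlyProperPart (R : Realization (Fin n) r) :
    Matrix (Fin n) (Fin n) (RatFunc ℂ) :=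
  R.C.map RatFunc.C * R.ratPencil⁻¹ * R.B.map RatFunc.C

theorem exists_proper_strictlyProperPart (R : Realization (Fin n) r) :
    ∃ F : Matrix (Fin n) (Fin n) (properSubalgebra ℂ),
      F.map (properSubalgebra ℂ).val = R.strictlyProperPart := by
  obtain ⟨F, hF⟩ := exists_proper_inv_pencil R.A R.isUnit_E
  refine ⟨R.C.map (algebraMap ℂ (properSubalgebra ℂ)) * F *
    R.B.map (algebraMap ℂ (properSubalgebra ℂ)), ?_⟩
  rw [Matrix.map_mul, Matrix.map_mul, hF]
  rfl

theorem inv_X_pow_smul_transfer (hdeg : ∀ j, m + 1 < j → R.coeff j = 0) :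
    ((RatFunc.X : RatFunc ℂ) ^ (m + 1))⁻¹ • R.transfer =
      (R.coeff (m + 1)).map RatFunc.C + ∑ j ∈ Finset.range m,
        (RatFunc.X : RatFunc ℂ)⁻¹ ^ (j + 1) • (R.coeff (m - j)).map RatFunc.C +
      (RatFunc.X : RatFunc ℂ)⁻¹ ^ (m + 1) • ((R.coeff 0).map RatFunc.C + R.strictlyProperPart) := by
  rw [← inv_pow_smul_sum_add_add RatFunc.X_ne_zero fun j => (R.coeff j).map RatFunc.C,
    transfer_eq_add, P_eq_sum_add_add hdeg]
  congr 1
  ext i j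
  simp only [strictlyProperPart, Matrix.add_apply, Matrix.map_apply, Matrix.sum_apply,
    Matrix.smul_apply, smul_eq_mul, map_add, map_sum, map_mul, map_pow, RatFunc.algebraMap_C,
    RatFunc.algebraMap_X]
  ring

/-- The realization whose system matrix is the Fiedler pencil `λ 𝕄_τ - 𝕄_0` with
`𝕄_τ` the product of the Fiedler matrices of the negative indices `-l`, `-m`, `-l'`. -/
noncomputable def fiedlerRealization (R : Realization (Fin n) r) (m : ℕ) (l l' : List ℕ) :
    Realization (Fin m × Fin n) r where
  P := (X : ℂ[X]) • (Matrix.comp _ _ _ _ _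
      (fiedlerProd m R.coeff l (R.coeff m) l')).map Polynomial.C -
    (diagLast m (-R.coeff 0)).map Polynomial.C
  A := R.A
  E := R.E
  B := lastRow m R.B
  C := lastCol m R.C
  det_E_ne_zero := R.det_E_ne_zero

theorem exists_units_mul_systemMatrix_fiedlerRealization_mul
    (hdeg : ∀ j, m + 1 < j → R.coeff j = 0) {l l' : List ℕ}
    (hl : (l ++ l').Perm (List.range' 1 m)) :
    ∃ U V : Matrix (Fin (m + 1) × Fin n) (Fin (m + 1) × Fin n) ℂ[X], IsUnit U ∧ IsUnit V ∧
      diagOneHom (Fin r) U * (R.fiedlerRealization (m + 1) l l').systemMatrix *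
        diagOneHom (Fin r) V = R.extendedSystemMatrix (m + 1) := by
  obtain ⟨U, V, h⟩ := exists_isReduction_fiedlerProd (X : ℂ[X])
    (fun j => (R.coeff j).map Polynomial.C) ((R.coeff (m + 1)).map Polynomial.C) hl
  refine ⟨Matrix.comp _ _ _ _ _ U, Matrix.comp _ _ _ _ _ V,
    (Matrix.isUnit_comp_iff _ _ _).2 h.isUnit_left, (Matrix.isUnit_comp_iff _ _ _).2 h.isUnit_right,
    ?_⟩
  rw [systemMatrix, diagOneHom_mul_fromBlocks_mul, extendedSystemMatrix, fiedlerRealization,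
    map_lastCol, map_lastRow, comp_mul_lastCol h.mulVec_last, lastRow_mul_comp h.last_vecMul,
    map_diagLast, smul_map_comp_fiedlerProd_sub_diagLast, ← comp_mul, ← comp_mul, h.mul_sub_mul,
    Matrix.map_neg _ (map_neg _), sub_neg_eq_add, ← P_eq_sum_add_add hdeg]
  rfl

theorem transfer_fiedlerRealization (R : Realization (Fin n) r) (m : ℕ) (l l' : List ℕ) :
    (R.fiedlerRealization m l l').transfer =
      (RatFunc.X : RatFunc ℂ) • (Matrix.comp _ _ _ _ _
        (fiedlerProd m R.coeff l (R.coeff m) l')).map RatFunc.C -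
      diagLast m (-((R.coeff 0).map RatFunc.C + R.strictlyProperPart)) := by
  have ratPencil_eq : (R.fiedlerRealization m l l').ratPencil = R.ratPencil := rfl
  have diagLast_eq : diagLast m ((-R.coeff 0).map RatFunc.C) =
      diagLast m (-((R.coeff 0).map RatFunc.C + R.strictlyProperPart)) +
        lastCol m (R.C.map RatFunc.C * R.ratPencil⁻¹) * lastRow m (R.B.map RatFunc.C) := by
    rw [diagLast_add_lastCol_mul_lastRow, ← strictlyProperPart, Matrix.map_neg _ (map_neg _)]
    congr 1
    abel
  rw [transfer_eq_add, ratPencil_eq, fiedlerRealization, map_algebraMap_pencil, map_diagLast,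
    map_lastCol, map_lastRow, lastCol_mul, diagLast_eq]
  abel

theorem exists_isBiproper_mul_transfer_fiedlerRealization_mul
    (hdeg : ∀ j, m + 1 < j → R.coeff j = 0) {l l' : List ℕ}
    (hl : (l ++ l').Perm (List.range' 1 m)) :
    ∃ Ol Or : Matrix (Fin (m + 1) × Fin n) (Fin (m + 1) × Fin n) (RatFunc ℂ),
      IsBiproper Ol ∧ IsBiproper Or ∧
      Ol * ((RatFunc.X : RatFunc ℂ)⁻¹ • (R.fiedlerRealization (m + 1) l l').transfer) * Or =
        diagLast (m + 1) (((RatFunc.X : RatFunc ℂ) ^ (m + 1))⁻¹ • R.transfer) := by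
  obtain ⟨F, hF⟩ := R.exists_proper_strictlyProperPart
  set ψ := algebraMap ℂ (properSubalgebra ℂ)
  set Z : Matrix (Fin n) (Fin n) (properSubalgebra ℂ) := -((R.coeff 0).map ψ + F) with hZ
  have equiv := (isEquivalent_fiedlerProd_sub_smul (properInvX ℂ) (fun j => (R.coeff j).map ψ)
    ((R.coeff (m + 1)).map ψ) Z hl).map (Matrix.compRingEquiv (Fin (m + 1)) (Fin n) _)
  obtain ⟨Ol, Or, hOl, hOr, h⟩ := exists_isBiproper_of_isEquivalent equiv
  refine ⟨Ol, Or, hOl, hOr, ?_⟩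
  have map_Z : Z.map (properSubalgebra ℂ).val =
      -((R.coeff 0).map RatFunc.C + R.strictlyProperPart) := by
    rw [hZ, Matrix.map_neg _ (map_neg _), Matrix.map_add _ (map_add _), hF]
    rfl
  have map_smul {ι : Type} (c : properSubalgebra ℂ) (M : Matrix ι ι (properSubalgebra ℂ)) :
      (c • M).map (properSubalgebra ℂ).val = c.val • M.map (properSubalgebra ℂ).val := rfl
  convert h using 1
  · rw [transfer_fiedlerRealization, smul_sub, inv_smul_smul₀ RatFunc.X_ne_zero, map_sub,
      Matrix.map_sub _ (map_sub _)]
    congr 3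
    · rw [Matrix.compRingEquiv_apply, ← map_comp_fiedlerProd]
      rfl
    · rw [← map_Z, ← map_diagLast]
      rfl
  · change _ = (diagLast (m + 1) _).map _
    rw [inv_X_pow_smul_transfer hdeg, map_diagLast, Matrix.map_sub _ (map_sub _),
      Matrix.map_add _ (map_add _), map_smul, map_Z, smul_neg, sub_neg_eq_add]
    congr 3
    exact (map_sum (AlgHom.mapMatrix (m := Fin n) (properSubalgebra ℂ).val)
      (fun j => properInvX ℂ ^ (j + 1) • (R.coeff (m - j)).map ψ) (Finset.range m)).symm

theorem isRosenbrockStrongLinearization_fiedlerRealization (hmin : R.IsMinimal)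
    (hdeg : ∀ j, m + 1 < j → R.coeff j = 0) {l l' : List ℕ}
    (hl : (l ++ l').Perm (List.range' 1 m)) :
    IsRosenbrockStrongLinearization (m + 1) R
      (R.fiedlerRealization (m + 1) l l').systemMatrix := by
  obtain ⟨U, V, hU, hV, h⟩ := exists_units_mul_systemMatrix_fiedlerRealization_mul hdeg hl
  refine ⟨_, ⟨-diagLast (m + 1) (-R.coeff 0), -Matrix.comp _ _ _ _ _
    (fiedlerProd (m + 1) R.coeff l (R.coeff (m + 1)) l'), ?_⟩, rfl, hmin.of_mul_systemMatrix_mul h,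
    ⟨U, V, 1, 1, isUnimodular_iff_isUnit.2 hU, isUnimodular_iff_isUnit.2 hV, by simp, by simp, ?_⟩,
    exists_isBiproper_mul_transfer_fiedlerRealization_mul hdeg hl⟩
  · rw [Matrix.map_neg _ (map_neg _), Matrix.map_neg _ (map_neg _), smul_neg, neg_sub_neg]
    rfl
  · rwa [Matrix.map_one _ (map_zero _) (map_one _)]

end Realization

end FiedlerRealization

section ElementaryMatrices

variable {m n : ℕ}

theorem elemBlocks_zero (W : Matrix (Fin n) (Fin n) ℂ) :
    elemBlocks m 0 W = blockDiagLast m W := by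
  ext1 p q
  simp only [elemBlocks, blockDiagLast, Matrix.of_apply, Matrix.diagonal_apply, if_true]
  split_ifs <;> first | rfl | omega

theorem elemBlocks_neg_self (W : Matrix (Fin n) (Fin n) ℂ) :
    elemBlocks m (-m) W = blockDiagFirst m W := by
  ext1 p q
  have hm : ¬-(m : ℤ) = 0 := by have := p.pos; omega
  simp only [elemBlocks, blockDiagFirst, Matrix.of_apply, Matrix.diagonal_apply, hm, if_true,
    if_false]
  split_ifs <;> first | rfl | omega

theorem elemBlocks_neg {i : ℕ} (hi : 1 ≤ i) (him : i < m) (W : Matrix (Fin n) (Fin n) ℂ) :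
    elemBlocks m (-i) W = swapBlock m i W := by
  ext1 p q
  have not_pos : ¬(0 : ℤ) < -(i : ℤ) := by omega
  have abs_eq : |(-(i : ℤ))| = i := by rw [abs_neg, Nat.abs_cast]
  simp only [elemBlocks, swapBlock, Matrix.of_apply, abs_eq, not_pos, if_false]
  split_ifs <;> first | rfl | omega

theorem elemBlocks_pos {i : ℕ} (hi : 1 ≤ i) (him : i < m) (W : Matrix (Fin n) (Fin n) ℂ) :
    elemBlocks m i W = blockRev m (swapBlock m (m - i) W) := by
  ext1 p q
  have hp := p.2
  have hq := q.2
  have i_pos : (0 : ℤ) < (i : ℤ) := by omega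
  simp only [elemBlocks, swapBlock, blockRev_apply, Matrix.of_apply, Nat.abs_cast, i_pos, if_true,
    Fin.rev_inj, Fin.val_rev]
  split_ifs <;> first | rfl | omega

theorem isUnit_swapBlock {S : Type*} [Ring S] {i : ℕ} (hi : 1 ≤ i) (him : i < m) (W : S) :
    IsUnit (swapBlock m i W) :=
  ⟨⟨_, _, swapBlock_mul_blockRev hi him W, blockRev_mul_swapBlock hi him W⟩, rfl⟩

theorem isUnit_elemM {i : ℤ} (hi : -m ≤ i) (him : i < m) {W : Matrix (Fin n) (Fin n) ℂ}
    (hW : i = 0 ∨ i = -m → W.det ≠ 0) : IsUnit (elemM m i W) := by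
  have isUnit_W (h : i = 0 ∨ i = -m) : IsUnit W :=
    (Matrix.isUnit_iff_isUnit_det W).2 (hW h).isUnit
  refine (Matrix.isUnit_comp_iff _ _ _).2 ?_
  obtain ⟨k, rfl | rfl⟩ := i.eq_nat_or_neg
  · rcases Nat.eq_zero_or_pos k with rfl | hk
    · exact elemBlocks_zero W ▸ isUnit_blockDiagLast m (isUnit_W (.inl rfl))
    · have isUnit_reflected : IsUnit (swapBlock m (m - k) W) :=
        isUnit_swapBlock (by omega) (by omega) W
      exact elemBlocks_pos (m := m) hk (by omega) W ▸ isUnit_reflected.map (blockRev m)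
  · rcases Nat.eq_zero_or_pos k with rfl | hk
    · exact elemBlocks_zero W ▸ isUnit_blockDiagLast m (isUnit_W (.inl rfl))
    · rcases eq_or_ne k m with rfl | hkm
      · exact elemBlocks_neg_self W ▸ isUnit_blockDiagFirst k (isUnit_W (.inr rfl))
      · exact elemBlocks_neg hk (m := m) (by omega) W ▸ isUnit_swapBlock hk (by omega) W

theorem exists_units_elemMMTuple_eq (r : ℕ) {t : List ℤ} (ht : ∀ i ∈ t, -m ≤ i ∧ i < m)
    {W : Fin t.length → Matrix (Fin n) (Fin n) ℂ} (hW : IsNonsingularAssignment m t W) :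
    ∃ U : (Matrix (Fin m × Fin n) (Fin m × Fin n) ℂ)ˣ,
      elemMMTuple m r t W = diagOneHom (Fin r) U.val := by
  obtain ⟨U, hU⟩ : IsUnit (List.ofFn fun j => elemM m (t.get j) (W j)).prod := by
    refine List.prod_isUnit fun M hM => ?_
    obtain ⟨j, rfl⟩ := (List.mem_ofFn' _ _).1 hM
    have hj := ht _ (List.get_mem t j)
    exact isUnit_elemM hj.1 hj.2 (hW j)
  refine ⟨U, ?_⟩
  rw [hU, map_list_prod, List.map_ofFn]
  rfl

end ElementaryMatrices

section FiedlerMatrices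

namespace Realization

variable {m n r : ℕ} (R : Realization (Fin n) r)

theorem fiedlerS_zero :
    R.fiedlerS m 0 =
      Matrix.fromBlocks (diagLast m (-R.coeff 0)) (-lastCol m R.C) (-lastRow m R.B) (-R.A) := by
  rw [fiedlerS, if_pos rfl, fiedlerP, if_pos le_rfl, elemM, elemBlocks_zero]
  rfl

theorem fiedlerS_neg_self (hm : 1 ≤ m) :
    R.fiedlerS m (-m) =
      Matrix.fromBlocks (Matrix.comp _ _ _ _ _ (blockDiagFirst m (R.coeff m))) 0 0 (-R.E) := by
  rw [fiedlerS, if_neg (by omega), if_pos rfl, fiedlerP, if_neg (by omega), elemM,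
    elemBlocks_neg_self, Int.natAbs_neg, Int.natAbs_natCast]

theorem exists_units_fiedlerS_pos_eq {i : ℕ} (hi : 1 ≤ i) (him : i < m) :
    ∃ U : (Matrix (Fin m × Fin n) (Fin m × Fin n) ℂ)ˣ,
      R.fiedlerS m i = diagOneHom (Fin r) U.val ∧
      (U⁻¹).val = Matrix.comp _ _ _ _ _ (swapBlock m i (R.coeff i)) := by
  have fiedlerP_eq : R.fiedlerP m i =
      Matrix.comp _ _ _ _ _ (blockRev m (swapBlock m (m - i) (-R.coeff i))) := by
    rw [fiedlerP, if_pos (by omega), elemM, elemBlocks_pos hi him, Int.natAbs_natCast]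
  refine ⟨⟨R.fiedlerP m i, Matrix.comp _ _ _ _ _ (swapBlock m i (R.coeff i)), ?_, ?_⟩, ?_, rfl⟩
  · rw [fiedlerP_eq, ← comp_mul, blockRev_mul_swapBlock hi him, Matrix.comp_one]
  · rw [fiedlerP_eq, ← comp_mul, swapBlock_mul_blockRev hi him, Matrix.comp_one]
  · rw [fiedlerS, if_neg (by omega), if_neg (by omega), if_pos (by omega)]
    rfl

theorem fiedlerS_neg {i : ℕ} (hi : 1 ≤ i) (him : i < m) :
    R.fiedlerS m (-i) =
      diagOneHom (Fin r) (Matrix.comp _ _ _ _ _ (swapBlock m i (R.coeff i))) := by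
  obtain ⟨U, hU, hUinv⟩ := R.exists_units_fiedlerS_pos_eq hi him
  rw [fiedlerS, if_neg (by omega), if_neg (by omega), if_pos (by omega)] at hU
  rw [fiedlerS, if_neg (by omega), if_neg (by omega), if_neg (by omega), neg_neg]
  refine Matrix.inv_eq_right_inv ?_
  rw [hU, ← hUinv, ← map_mul, Units.mul_inv, map_one]

theorem fiedlerSTuple_cons (i : ℤ) (t : List ℤ) :
    R.fiedlerSTuple m (i :: t) = R.fiedlerS m i * R.fiedlerSTuple m t := by
  simp [fiedlerSTuple]

theorem fiedlerSTuple_append_cons (s t : List ℤ) (i : ℤ) :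
    R.fiedlerSTuple m (s ++ i :: t) =
      R.fiedlerSTuple m s * R.fiedlerS m i * R.fiedlerSTuple m t := by
  simp [fiedlerSTuple, mul_assoc]

theorem fiedlerSTuple_of_neg {t : List ℤ} (ht : ∀ i ∈ t, -m < i ∧ i < 0) :
    R.fiedlerSTuple m t =
      diagOneHom (Fin r) (Matrix.comp _ _ _ _ _ (swapProd m R.coeff (t.map Int.natAbs))) := by
  induction t with
  | nil => simp [fiedlerSTuple, swapProd, Matrix.comp_one]
  | cons i t ih =>
    obtain ⟨⟨hi, him⟩, ht'⟩ := List.forall_mem_cons.1 ht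
    obtain ⟨k, rfl⟩ : ∃ k : ℕ, i = -(k : ℤ) := ⟨i.natAbs, by omega⟩
    rw [fiedlerSTuple_cons, ih ht', R.fiedlerS_neg (by omega) (by omega), ← map_mul, ← comp_mul,
      List.map_cons, Int.natAbs_neg, Int.natAbs_natCast, swapProd_cons]

theorem exists_units_fiedlerSTuple_eq {t : List ℤ} (ht : ∀ i ∈ t, 0 < i ∧ i < m) :
    ∃ U : (Matrix (Fin m × Fin n) (Fin m × Fin n) ℂ)ˣ,
      R.fiedlerSTuple m t = diagOneHom (Fin r) U.val ∧
      (U⁻¹).val = Matrix.comp _ _ _ _ _ (swapProd m R.coeff (t.map Int.natAbs).reverse) := by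
  induction t with
  | nil => exact ⟨1, by simp [fiedlerSTuple, swapProd, Matrix.comp_one]⟩
  | cons i t ih =>
    obtain ⟨⟨hi, him⟩, ht'⟩ := List.forall_mem_cons.1 ht
    obtain ⟨k, rfl⟩ : ∃ k : ℕ, i = k := ⟨i.natAbs, by omega⟩
    obtain ⟨V, hV, hVinv⟩ := R.exists_units_fiedlerS_pos_eq (m := m) (i := k) (by omega) (by omega)
    obtain ⟨U, hU, hUinv⟩ := ih ht'
    refine ⟨V * U, ?_, ?_⟩
    · rw [fiedlerSTuple_cons, hV, hU, Units.val_mul, map_mul]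
    · rw [mul_inv_rev, Units.val_mul, hUinv, hVinv, ← comp_mul, List.map_cons, List.reverse_cons,
        Int.natAbs_natCast, swapProd_append]
      simp [swapProd]

theorem systemMatrix_fiedlerRealization (hm : 1 ≤ m) (l l' : List ℕ) :
    (R.fiedlerRealization m l l').systemMatrix =
      (X : ℂ[X]) • (diagOneHom (Fin r) (Matrix.comp _ _ _ _ _ (swapProd m R.coeff l)) *
        R.fiedlerS m (-m) *
        diagOneHom (Fin r) (Matrix.comp _ _ _ _ _ (swapProd m R.coeff l'))).map Polynomial.C -
      (R.fiedlerS m 0).map Polynomial.C := by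
  rw [R.fiedlerS_neg_self hm, diagOneHom_mul_fromBlocks_mul, fiedlerS_zero, ← comp_mul, ← comp_mul]
  simp [systemMatrix, fiedlerRealization, fiedlerProd, Matrix.fromBlocks_map,
    Matrix.fromBlocks_smul, Matrix.map_neg, sub_eq_add_neg, Matrix.fromBlocks_neg,
    Matrix.fromBlocks_add, add_comm]

theorem exists_fiedlerSTuple_pencil_eq {a b c d : List ℤ} (ha : ∀ i ∈ a, 0 < i ∧ i < m)
    (hb : ∀ i ∈ b, 0 < i ∧ i < m) (hc : ∀ i ∈ c, -m < i ∧ i < 0) (hd : ∀ i ∈ d, -m < i ∧ i < 0)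
    (hm : 1 ≤ m) :
    ∃ M N : (Matrix (Fin m × Fin n) (Fin m × Fin n) ℂ)ˣ,
      (X : ℂ[X]) • (R.fiedlerSTuple m (c ++ -(m : ℤ) :: d)).map Polynomial.C -
        (R.fiedlerSTuple m (a ++ 0 :: b)).map Polynomial.C =
      diagOneHom (Fin r) (M.val.map Polynomial.C) *
        (R.fiedlerRealization m ((a.map Int.natAbs).reverse ++ c.map Int.natAbs)
          (d.map Int.natAbs ++ (b.map Int.natAbs).reverse)).systemMatrix *
        diagOneHom (Fin r) (N.val.map Polynomial.C) := by
  obtain ⟨M, hM, hMinv⟩ := R.exists_units_fiedlerSTuple_eq ha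
  obtain ⟨N, hN, hNinv⟩ := R.exists_units_fiedlerSTuple_eq hb
  refine ⟨M, N, ?_⟩
  rw [fiedlerSTuple_append_cons, fiedlerSTuple_append_cons, hM, hN, R.fiedlerSTuple_of_neg hc,
    R.fiedlerSTuple_of_neg hd, R.systemMatrix_fiedlerRealization hm, swapProd_append,
    swapProd_append, comp_mul, comp_mul, ← hMinv, ← hNinv, ← diagOneHom_map_C, ← diagOneHom_map_C,
    Matrix.mul_sub, Matrix.sub_mul, Matrix.mul_smul, Matrix.smul_mul, ← Matrix.map_mul,
    ← Matrix.map_mul, ← Matrix.map_mul, ← Matrix.map_mul]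
  simp only [← mul_assoc, ← map_mul, Units.mul_inv, one_mul]
  simp only [mul_assoc, ← map_mul, Units.inv_mul, mul_one]

end Realization

end FiedlerMatrices

section IndexTuples

theorem perm_range'_of_perm_range {m : ℕ} {a b c d : List ℕ}
    (h : (a ++ 0 :: b ++ (c ++ (m + 1) :: d)).Perm (List.range (m + 2))) :
    (a.reverse ++ c ++ (d ++ b.reverse)).Perm (List.range' 1 m) := by
  have range_eq : List.range (m + 2) = 0 :: (List.range' 1 m ++ [m + 1]) := by
    rw [List.range_eq_range', List.range'_succ, List.range'_1_concat, add_comm 1 m]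
  rw [range_eq, List.perm_iff_count] at h
  rw [List.perm_iff_count]
  intro i
  have count_eq := h i
  simp only [List.append_assoc, List.cons_append, List.count_append, List.count_cons,
    List.count_nil, List.count_reverse] at count_eq ⊢
  omega

theorem IsPermutationOf.map_natAbs_append_perm_range {σ τ : List ℤ} {h m : ℕ}
    (hσ : IsPermutationOf σ 0 h) (hτ : IsPermutationOf τ (-m) (-h - 1)) (hm : h ≤ m) :
    ((σ ++ τ).map Int.natAbs).Perm (List.range (m + 1)) := by
  obtain ⟨hσ, mem_σ⟩ := hσ
  obtain ⟨hτ, mem_τ⟩ := hτ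
  have nodup : (σ ++ τ).Nodup := hσ.append hτ fun i hi hi' => by
    have := (mem_σ i).1 hi
    have := (mem_τ i).1 hi'
    omega
  have mem_iff (i : ℤ) : i ∈ σ ++ τ ↔ 0 ≤ i ∧ i ≤ h ∨ -m ≤ i ∧ i ≤ -h - 1 := by
    rw [List.mem_append, mem_σ, mem_τ]
  refine (List.perm_ext_iff_of_nodup (nodup.map_on fun i hi j hj hij => ?_) List.nodup_range).2
    fun k => ?_
  · have := (mem_iff i).1 hi
    have := (mem_iff j).1 hj
    omega
  · simp only [List.mem_map, mem_iff, List.mem_range]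
    refine ⟨fun ⟨i, hi, hik⟩ => by omega, fun hk => ?_⟩
    rcases le_or_gt k h with hkh | hkh
    · exact ⟨k, by omega, by omega⟩
    · exact ⟨-k, by omega, by omega⟩

theorem exists_append_of_perm_range {σ τ : List ℤ} {m : ℕ} (hσ : ∀ i ∈ σ, 0 ≤ i ∧ i < m)
    (hτ : ∀ i ∈ τ, -m ≤ i ∧ i < 0)
    (hστ : ((σ ++ τ).map Int.natAbs).Perm (List.range (m + 1))) :
    ∃ a b c d : List ℤ, σ = a ++ 0 :: b ∧ τ = c ++ -(m : ℤ) :: d ∧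
      (∀ i ∈ a, 0 < i ∧ i < m) ∧ (∀ i ∈ b, 0 < i ∧ i < m) ∧
      (∀ i ∈ c, -m < i ∧ i < 0) ∧ (∀ i ∈ d, -m < i ∧ i < 0) := by
  have exists_natAbs_eq {k : ℕ} (hk : k ≤ m) : ∃ i, (i ∈ σ ∨ i ∈ τ) ∧ i.natAbs = k := by
    simpa [or_and_right, exists_or] using hστ.mem_iff.2 (List.mem_range.2 (Nat.lt_succ_of_le hk))
  have zero_mem : 0 ∈ σ := by
    obtain ⟨i, hi | hi, hi0⟩ := exists_natAbs_eq (Nat.zero_le m) <;>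
    grind
  have neg_mem : -(m : ℤ) ∈ τ := by
    obtain ⟨i, hi | hi, him⟩ := exists_natAbs_eq le_rfl <;>
    grind
  have nodup : ((σ ++ τ).map Int.natAbs).Nodup := hστ.nodup_iff.2 List.nodup_range
  have nodup_σ := (List.nodup_append.1 nodup.of_map).1
  have nodup_τ := (List.nodup_append.1 nodup.of_map).2.1
  obtain ⟨a, b, rfl⟩ := List.append_of_mem zero_mem
  obtain ⟨c, d, rfl⟩ := List.append_of_mem neg_mem
  refine ⟨a, b, c, d, rfl, rfl, fun i hi => ?_, fun i hi => ?_, fun i hi => ?_, fun i hi => ?_⟩ <;>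
    grind

end IndexTuples

section GeneralizedFiedlerPencils

namespace Realization

theorem isRosenbrockStrongLinearization_fiedlerSTuple_pencil {m n r : ℕ}
    {R : Realization (Fin n) r} (hdeg : ∀ j, m < j → R.coeff j = 0) (hmin : R.IsMinimal)
    {σ τ : List ℤ} (hσ : ∀ i ∈ σ, 0 ≤ i ∧ i < m) (hτ : ∀ i ∈ τ, -m ≤ i ∧ i < 0)
    (hστ : ((σ ++ τ).map Int.natAbs).Perm (List.range (m + 1))) :
    IsRosenbrockStrongLinearization m R
      ((X : ℂ[X]) • (R.fiedlerSTuple m τ).map Polynomial.C -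
        (R.fiedlerSTuple m σ).map Polynomial.C) := by
  obtain ⟨a, b, c, d, rfl, rfl, ha, hb, hc, hd⟩ := exists_append_of_perm_range hσ hτ hστ
  obtain ⟨k, rfl⟩ : ∃ k, m = k + 1 :=
    Nat.exists_eq_add_one.2 (by simpa using (hσ 0 (by simp)).2)
  obtain ⟨M, N, pencil_eq⟩ := R.exists_fiedlerSTuple_pencil_eq ha hb hc hd k.succ_pos
  have perm : ((a.map Int.natAbs).reverse ++ c.map Int.natAbs ++
      (d.map Int.natAbs ++ (b.map Int.natAbs).reverse)).Perm (List.range' 1 k) := by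
    refine perm_range'_of_perm_range ?_
    have natAbs_eq : (-1 + -(k : ℤ)).natAbs = k + 1 := by omega
    simpa [natAbs_eq] using hστ
  rw [pencil_eq]
  exact (isRosenbrockStrongLinearization_fiedlerRealization hmin hdeg perm).diagOneHom_mul_mul M N

end Realization

theorem theorem3p11_general {n r m : ℕ} (R : Realization (Fin n) r)
    (hdeg : ∀ j, m < j → R.coeff j = 0) (hmin : R.IsMinimal)
    (σ τ σ₁ σ₂ τ₁ τ₂ : List ℤ)
    (hσ : ∀ i ∈ σ, 0 ≤ i ∧ i < m) (hτ : ∀ i ∈ τ, -m ≤ i ∧ i < 0)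
    (hστ : ((σ ++ τ).map Int.natAbs).Perm (List.range (m + 1)))
    (hσ₁ : ∀ i ∈ σ₁, -m ≤ i ∧ i < m) (hσ₂ : ∀ i ∈ σ₂, -m ≤ i ∧ i < m)
    (hτ₁ : ∀ i ∈ τ₁, -m ≤ i ∧ i < m) (hτ₂ : ∀ i ∈ τ₂, -m ≤ i ∧ i < m)
    (X₁ : Fin σ₁.length → Matrix (Fin n) (Fin n) ℂ)
    (X₂ : Fin σ₂.length → Matrix (Fin n) (Fin n) ℂ)
    (Y₁ : Fin τ₁.length → Matrix (Fin n) (Fin n) ℂ)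
    (Y₂ : Fin τ₂.length → Matrix (Fin n) (Fin n) ℂ)
    (hX₁ : IsNonsingularAssignment m σ₁ X₁) (hX₂ : IsNonsingularAssignment m σ₂ X₂)
    (hY₁ : IsNonsingularAssignment m τ₁ Y₁) (hY₂ : IsNonsingularAssignment m τ₂ Y₂) :
    IsRosenbrockStrongLinearization m R
      (R.gfprPencil m σ τ σ₁ σ₂ τ₁ τ₂ X₁ X₂ Y₁ Y₂) := by
  obtain ⟨M₁, hM₁⟩ := exists_units_elemMMTuple_eq r hσ₁ hX₁
  obtain ⟨M₂, hM₂⟩ := exists_units_elemMMTuple_eq r hσ₂ hX₂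
  obtain ⟨N₁, hN₁⟩ := exists_units_elemMMTuple_eq r hτ₁ hY₁
  obtain ⟨N₂, hN₂⟩ := exists_units_elemMMTuple_eq r hτ₂ hY₂
  have key := ((Realization.isRosenbrockStrongLinearization_fiedlerSTuple_pencil hdeg hmin hσ hτ
    hστ).diagOneHom_mul_mul M₁ M₂).diagOneHom_mul_mul N₁ N₂
  rw [Realization.gfprPencil, hM₁, hM₂, hN₁, hN₂]
  simpa only [diagOneHom_map_C, mul_assoc] using key

end GeneralizedFiedlerPencils

theorem theorem3p11 {n r m : ℕ} (R : Realization (Fin n) r)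
    (hdeg : ∀ j, m < j → R.coeff j = 0) (hlead : R.coeff m ≠ 0) (hmin : R.IsMinimal)
    (h : ℕ) (hm : h + 1 ≤ m)
    (σ τ σ₁ σ₂ τ₁ τ₂ : List ℤ)
    (hσ : IsPermutationOf σ 0 h) (hτ : IsPermutationOf τ (-m) (-h - 1))
    (hσ₁ : ∀ i ∈ σ₁, 0 ≤ i ∧ i ≤ (h : ℤ) - 1) (hσ₂ : ∀ i ∈ σ₂, 0 ≤ i ∧ i ≤ (h : ℤ) - 1)
    (hσSIP : SatisfiesSIP (σ₁ ++ σ ++ σ₂))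
    (hτ₁ : ∀ i ∈ τ₁, -(m : ℤ) ≤ i ∧ i ≤ -(h : ℤ) - 2)
    (hτ₂ : ∀ i ∈ τ₂, -(m : ℤ) ≤ i ∧ i ≤ -(h : ℤ) - 2)
    (hτSIP : SatisfiesSIP (τ₁ ++ τ ++ τ₂))
    (X₁ : Fin σ₁.length → Matrix (Fin n) (Fin n) ℂ)
    (X₂ : Fin σ₂.length → Matrix (Fin n) (Fin n) ℂ)
    (Y₁ : Fin τ₁.length → Matrix (Fin n) (Fin n) ℂ)
    (Y₂ : Fin τ₂.length → Matrix (Fin n) (Fin n) ℂ)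
    (hX₁ : IsNonsingularAssignment m σ₁ X₁) (hX₂ : IsNonsingularAssignment m σ₂ X₂)
    (hY₁ : IsNonsingularAssignment m τ₁ Y₁) (hY₂ : IsNonsingularAssignment m τ₂ Y₂) :
    IsRosenbrockStrongLinearization m R
      (R.gfprPencil m σ τ σ₁ σ₂ τ₁ τ₂ X₁ X₂ Y₁ Y₂) := by
  refine theorem3p11_general R hdeg hmin σ τ σ₁ σ₂ τ₁ τ₂ ?_ ?_
    (hσ.map_natAbs_append_perm_range hτ (by omega)) ?_ ?_ ?_ ?_ X₁ X₂ Y₁ Y₂ hX₁ hX₂ hY₁ hY₂ <;>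
  grind [IsPermutationOf]
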